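/- Let $n=2j\ge 0$ be an integer, and let $\varphi_j$ be the irreducible unitary representation of $SU(2)$ on $\mathcal H_j\simeq\mathbb C^{n+1}$, written in its standard basis, so that the lowering operator $J_-$ has the subdiagonal entries $\sqrt{n\cdot 1},\sqrt{(n-1)\cdot 2},\dots,\sqrt{1\cdot n}$, and $J_+=J_-^{T}$. Rotations $g\in SO(3)$ act on operators $P\in M_{\mathbb C}(n+1)$ by $P^g=\varphi_j(U)P\varphi_j(U)^{-1}$, where $U\in SU(2)$ is any lift of $g$ under the standard covering $SU(2)\to SO(3)$, and on functions on $S^2$ by $F^g(\mathbf n)=F(g^{-1}\mathbf n)$. Write $\langle P,Q\rangle=\operatorname{trace}(P^*Q)$ and $\langle F_1,F_2\rangle=\frac1{4\pi}\int_{S^2}\overline{F_1}F_2\,dS$. A symbol correspondence is an injective linear map $P\mapsto W_P$ from $M_{\mathbb C}(n+1)$ to the smooth complex functions on $S^2$ such that $W_{P^g}=(W_P)^g$ for all $g\in SO(3)$, $W_{P^*}=\overline{W_P}$, and $\frac1{4\pi}\int_{S^2}W_P\,dS=\frac1{n+1}\operatorname{trace}(P)$. It is a Stratonovich-Weyl correspondence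 if moreover $\langle W_P,W_Q\rangle=\frac1{n+1}\langle P,Q\rangle$ for all $P,Q$. For $0\le l\le n$ let $\mathbf e(l,l)=(-1)^l J_+^l/\|J_+^l\|$ (Hilbert-Schmidt norm) and $\mathbf e(l,m-1)=[J_-,\mathbf e(l,m)]/\sqrt{(l+m)(l-m+1)}$ for $-l<m\le l$, and let $P_l=\sum_{m=-l}^{l}\langle \mathbf e(l,m),P\rangle\,\mathbf e(l,m)$. Then $P=\sum_{l=0}^nP_l$ for every operator $P$. With $\mathbf n_0=(0,0,1)$, let the operator kernel $K$ of $W$ be the matrix with $W_P(\mathbf n_0)=\operatorname{trace}(PK)$ for all $P$, let $\gamma_l=\operatorname{Re}\langle\mathbf e(l,0),K\rangle$, and define the characteristic numbers $c_l$ of $W$ by $\gamma_l=c_l\sqrt{\frac{2l+1}{n+1}}$, $0\le l\le n$. Then: (1) For every symbol correspondence $W$, $W_P(g\mathbf n_0)=\operatorname{trace}(PK^g)$ for all $P$ and all $g\in SO(3)$, $K=\sum_{l=0}^n c_l\sqrt{\frac{2l+1}{n+1}}\,\mathbf e(l,0)$, $c_0=1$, and $c_l\neq0$ for $1\le l\le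 n$. (2) For every symbol correspondence $W$ and all operators $P,Q$, $$\langle W_P,W_Q\rangle=\sum_{l=0}^n\frac{\gamma_l^2}{2l+1}\langle P_l,Q_l\rangle=\sum_{l=0}^n\frac{c_l^2}{n+1}\langle P_l,Q_l\rangle .$$ (3) $W$ is a Stratonovich-Weyl correspondence if and only if $c_l=\pm1$ for $l=1,\dots,n$, and there are precisely $2^n$ Stratonovich-Weyl correspondences. (4) With the topology of pointwise convergence of all symbols, the moduli space of all symbol correspondences is homeomorphic to $(\mathbb R^*)^n$, where $\mathbb R^*=\mathbb R\setminus\{0\}$, through $W\mapsto(c_1,\dots,c_n)$. It has $2^n$ connected components; each of them contains a unique Stratonovich-Weyl correspondence, and the moduli space can be continuously deformed onto the set of Stratonovich-Weyl correspondences keeping these fixed. -/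

import Mathlib

open scoped Manifold ContDiff Matrix ComplexConjugate
open MeasureTheory

noncomputable section

namespace SpinSystem

/-! ### The groups `SU(2)`, `SO(3)` and the sphere -/

/-- The group `SU(2)`. -/
abbrev SU2 : Type := Matrix.specialUnitaryGroup (Fin 2) ℂ

/-- The group `SO(3)`. -/
abbrev SO3 : Type := Matrix.specialOrthogonalGroup (Fin 3) ℝ

/-- The unit sphere `S²` of Euclidean 3-space. -/
abbrev S2 : Type := Metric.sphere (0 : EuclideanSpace ℝ (Fin 3)) 1

instance instFactFinrank : Fact (Module.finrank ℝ (EuclideanSpace ℝ (Fin 3)) = 2 + 1) :=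
  ⟨by simp⟩

/-- The Hermitian matrix `v · σ = v₁ σ₁ + v₂ σ₂ + v₃ σ₃` (with the Pauli matrices `σₖ`). -/
def pauliDot (v : Fin 3 → ℝ) : Matrix (Fin 2) (Fin 2) ℂ :=
  (v 0 : ℂ) • !![0, 1; 1, 0] + (v 1 : ℂ) • !![0, -Complex.I; Complex.I, 0]
    + (v 2 : ℂ) • !![1, 0; 0, -1]

/-- `Covers U R` says that the standard covering homomorphism `SU(2) → SO(3)` maps `U` to `R`:
`U (v · σ) U⁻¹ = (R v) · σ` for all `v`. -/
def Covers (U : SU2) (R : SO3) : Prop :=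
  ∀ v : Fin 3 → ℝ,
    (U : Matrix (Fin 2) (Fin 2) ℂ) * pauliDot v * ((U⁻¹ : SU2) : Matrix (Fin 2) (Fin 2) ℂ)
      = pauliDot ((R : Matrix (Fin 3) (Fin 3) ℝ) *ᵥ v)

theorem sum_sq_mulVec (R : SO3) (v : Fin 3 → ℝ) :
    ∑ i, ((R : Matrix (Fin 3) (Fin 3) ℝ) *ᵥ v) i ^ 2 = ∑ i, v i ^ 2 := by
  have h1 : (R : Matrix (Fin 3) (Fin 3) ℝ)ᵀ * (R : Matrix (Fin 3) (Fin 3) ℝ) = 1 := by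
    have h := (Matrix.mem_specialOrthogonalGroup_iff.1 R.2).1
    exact (Matrix.mem_orthogonalGroup_iff' (Fin 3) ℝ).1 h
  have h2 : ((R : Matrix (Fin 3) (Fin 3) ℝ) *ᵥ v) ⬝ᵥ ((R : Matrix (Fin 3) (Fin 3) ℝ) *ᵥ v)
      = v ⬝ᵥ v := by
    rw [Matrix.dotProduct_mulVec, ← Matrix.mulVec_transpose, Matrix.mulVec_mulVec, h1,
      Matrix.one_mulVec]
  simpa [dotProduct, pow_two] using h2

/-- The action of a rotation on the sphere. -/
def rotate (R : SO3) (x : S2) : S2 :=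
  ⟨WithLp.toLp 2 ((R : Matrix (Fin 3) (Fin 3) ℝ) *ᵥ (x : EuclideanSpace ℝ (Fin 3)).ofLp), by
    have hx : ‖(x : EuclideanSpace ℝ (Fin 3))‖ = 1 := by simpa using x.2
    rw [mem_sphere_zero_iff_norm]
    rw [EuclideanSpace.norm_eq] at hx ⊢
    simpa [sum_sq_mulVec] using hx⟩

/-- The north pole `n₀ = (0, 0, 1)`. -/
def northPole : S2 :=
  ⟨WithLp.toLp 2 ![0, 0, 1], by
    rw [mem_sphere_zero_iff_norm, EuclideanSpace.norm_eq]
    simp [Fin.sum_univ_three]⟩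

/-- The normalized integral `(1 / 4π) ∫_{S²} F dS`; `volume.toSphere` is the surface measure. -/
def sphereMean (F : S2 → ℂ) : ℂ :=
  ((1 / (4 * Real.pi) : ℝ) : ℂ) *
    ∫ x, F x ∂(volume : Measure (EuclideanSpace ℝ (Fin 3))).toSphere

/-- The normalized `L²` inner product on functions on the sphere, conjugate linear in the first
variable. -/
def sphereInner (F G : S2 → ℂ) : ℂ := sphereMean fun x => conj (F x) * G x

/-! ### The spin-`j` system, `n = 2j`, in its standard basis -/

/-- Operators on `ℋ_j ≃ ℂⁿ⁺¹`, written in the standard basis `|j, j⟩, |j, j - 1⟩, …, |j, -j⟩`. -/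
abbrev Op (n : ℕ) : Type := Matrix (Fin (n + 1)) (Fin (n + 1)) ℂ

/-- The irreducible unitary representation `φ_j` of `SU(2)`, as matrices in the standard basis
`v(n, k) = √(n choose k) z₁ⁿ⁻ᵏ z₂ᵏ` of homogeneous polynomials of degree `n` in the basis vectors
`z₁, z₂` of `ℂ²`, that is, with `g z₁ = g₁₁ z₁ + g₂₁ z₂` and `g z₂ = g₁₂ z₁ + g₂₂ z₂`. The
coefficients are read off after setting `z₁ = 1`, `z₂ = X`. -/
def spinRep (n : ℕ) (g : Matrix (Fin 2) (Fin 2) ℂ) : Op n := fun a b =>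
  ((√(n.choose b : ℝ) / √(n.choose a : ℝ) : ℝ) : ℂ) *
    (((Polynomial.C (g 0 0) + Polynomial.C (g 1 0) * Polynomial.X) ^ (n - (b : ℕ)) *
      (Polynomial.C (g 0 1) + Polynomial.C (g 1 1) * Polynomial.X) ^ (b : ℕ)).coeff (a : ℕ))

/-- The action `P ↦ P^g = φ_j(g) P φ_j(g⁻¹)` on operators. -/
def opAct {n : ℕ} (U : SU2) (P : Op n) : Op n :=
  spinRep n (U : Matrix (Fin 2) (Fin 2) ℂ) * P *
    spinRep n ((U⁻¹ : SU2) : Matrix (Fin 2) (Fin 2) ℂ)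

/-- The Hilbert-Schmidt inner product `⟨P, Q⟩ = trace (P* Q)`. -/
def hsInner {n : ℕ} (P Q : Op n) : ℂ := (Pᴴ * Q).trace

/-- The lowering operator `J₋`, with subdiagonal entries `√(n·1), √((n-1)·2), …, √(1·n)`. -/
def Jminus (n : ℕ) : Op n := fun a b =>
  if (a : ℕ) = (b : ℕ) + 1 then ((√(((n : ℝ) - (b : ℕ)) * ((b : ℕ) + 1)) : ℝ) : ℂ) else 0

/-- The raising operator `J₊ = J₋ᵀ`. -/
def Jplus (n : ℕ) : Op n := (Jminus n)ᵀ

/-- The Hilbert-Schmidt norm `μ_l = ‖(J₊)^l‖ = √(trace ((J₋)^l (J₊)^l))`. -/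
def mu (n l : ℕ) : ℝ := √(((Jminus n ^ l * Jplus n ^ l).trace).re)

/-- `basisAux n l k = e(l, l - k)`: start from `e(l, l) = (-1)^l (J₊)^l / μ_l` and lower by
`e(l, m - 1) = [J₋, e(l, m)] / β_{l,m}`, where `β_{l,m} = √((l + m)(l - m + 1))` and `m = l - k`. -/
def basisAux (n l : ℕ) : ℕ → Op n
  | 0 => (((-1) ^ l / mu n l : ℝ) : ℂ) • Jplus n ^ l
  | k + 1 => ((1 / √((2 * (l : ℝ) - k) * (k + 1)) : ℝ) : ℂ) •
      (Jminus n * basisAux n l k - basisAux n l k * Jminus n)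

/-- The coupled standard basis `e(l, m)` of the operator space, `0 ≤ l ≤ n`, `-l ≤ m ≤ l`. -/
def e (n l : ℕ) (m : ℤ) : Op n := basisAux n l ((l : ℤ) - m).toNat

/-- The component `P_l` of `P` in the irreducible summand `M_ℂ(φ_l)`, the span of
`e(l, -l), …, e(l, l)`. -/
def component {n : ℕ} (l : ℕ) (P : Op n) : Op n :=
  ∑ m ∈ Finset.Icc (-(l : ℤ)) l, hsInner (e n l m) P • e n l m

/-! ### Symbol correspondences -/

/-- `W` is a symbol correspondence for the spin-`j` system, `n = 2j`. -/
structure IsSymbolCorrespondence (n : ℕ) (W : Op n →ₗ[ℂ] (S2 → ℂ)) : Prop where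
  /-- Symbols are smooth functions. -/
  smooth : ∀ P, ContMDiff (𝓡 2) 𝓘(ℝ, ℂ) ∞ (W P)
  /-- (i) `W` is linear and injective. -/
  injective : Function.Injective W
  /-- (ii) `W_{P^g} = (W_P)^g` for each rotation `g = R`, where `R` acts on operators through any
  `U` in `SU(2)` lying over it, and `F^g(x) = F(g⁻¹ x)`. -/
  equivariant : ∀ (R : SO3) (U : SU2), Covers U R → ∀ (P : Op n) (x : S2),
    W (opAct U P) x = W P (rotate R⁻¹ x)
  /-- (iii) Reality. -/
  reality : ∀ (P : Op n) (x : S2), W Pᴴ x = conj (W P x)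
  /-- (iv) Normalization. -/
  normalization : ∀ P : Op n, sphereMean (W P) = 1 / ((n : ℂ) + 1) * P.trace

/-- The moduli space of all symbol correspondences. -/
def SymbolCorrespondence (n : ℕ) : Type :=
  {W : Op n →ₗ[ℂ] (S2 → ℂ) // IsSymbolCorrespondence n W}

namespace SymbolCorrespondence

variable {n : ℕ}

/-- The symbol `W_P` of an operator `P`. -/
def symbol (W : SymbolCorrespondence n) (P : Op n) : S2 → ℂ := W.1 P

/-- The topology of pointwise convergence of all symbols. -/
instance instTopologicalSpace : TopologicalSpace (SymbolCorrespondence n) :=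
  TopologicalSpace.induced (fun W => fun (P : Op n) (x : S2) => W.symbol P x)
    (Pi.topologicalSpace (ι := Op n))

/-- `W` is a Stratonovich-Weyl correspondence: (v) `⟨W_P, W_Q⟩ = ⟨P, Q⟩ / (n + 1)`. -/
def IsStratonovichWeyl (W : SymbolCorrespondence n) : Prop :=
  ∀ P Q : Op n, sphereInner (W.symbol P) (W.symbol Q) = 1 / ((n : ℂ) + 1) * hsInner P Q

/-- The operator kernel `K`: the matrix with `W_P(n₀) = trace (P K)` for all `P`. -/
def kernel (W : SymbolCorrespondence n) : Op n := fun a b =>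
  W.symbol (Matrix.single b a 1) northPole

/-- The coefficients `γ_l` in `K = ∑ γ_l e(l, 0)`. -/
def gamma (W : SymbolCorrespondence n) (l : ℕ) : ℝ := (hsInner (e n l 0) W.kernel).re

/-- The characteristic numbers `c_l`: `γ_l = c_l √((2 l + 1) / (n + 1))`. -/
def charNumber (W : SymbolCorrespondence n) (l : ℕ) : ℝ :=
  W.gamma l / √((2 * (l : ℝ) + 1) / (n + 1))

end SymbolCorrespondence

end SpinSystem

end

noncomputable section

namespace SpinSystem

/-! ### The homomorphism property of `spinRep` -/

/-! Covariance determines a correspondence by its values at the north pole: W_P(g n₀) = trace(P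
K^g). Rotations about the third axis fix the pole, so K commutes with J₃; since e(l, m) has weight
m, only the e(l, 0) survive in K, and reality makes their coefficients γ_l real
(`IsCovariant.lie_Jthree_kernelOf`, `IsCovariant.kernelOf_eq`).

The metric identity is Schur's lemma together with a trace. The L² product pulled back to operators
is invariant under SU(2), hence, by differentiation, under commutators with the angular momentum.
For any such form the eigenvalues of J₃ and of the Casimir operator make the e(l, m) orthogonal, and
the ladder operators make the diagonal depend on l alone (`IsAdInvariant.eq_sum`). The sum over m of
|W_{e(l,m)}(x)|² is the squared norm of the degree l part of a rotated kernel, which is γ_l² at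
every x; so the constant for degree l is γ_l²/(2l+1) (`sum_normSq_trace_e_mul_opAct_zonalKernel`,
`IsCovariant.sphereInner_eq`). Injectivity, normalization and the Stratonovich-Weyl condition
thereby become c_l ≠ 0, c_0 = 1 and c_l² = 1.

Conversely every real diagonal matrix is p(J₃) for a real polynomial p, and P ↦ trace(P p(x·J)) is
smooth, covariant and real with kernel p(J₃); so all nonzero c_1, …, c_n occur
(`exists_symbolCorrespondence`). Each value of a symbol is affine in the c_l, and each c_l is a
real-linear function of finitely many symbol values, which gives the homeomorphism. Scaling c_l by 1
- t + t/|c_l| retracts the moduli space onto the sign vectors, and signs are constant on connected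
sets because no c_l vanishes.

Underneath lies the fact that J is a vector operator (`opAct_spinDot`), obtained by differentiating
the explicit matrices `spinRep`. Unitarity of the representation is never used: a rotated p(J₃) is
p(v·J) for a unit vector v, which is visibly Hermitian. -/

open Polynomial in
/-- The homogenization of degree `N` of a polynomial, evaluated at `(u, v)`. -/
def homogEval {A : Type*} [CommRing A] [Algebra ℂ A] (N : ℕ) (q : ℂ[X]) (u v : A) : A :=
  ∑ c ∈ Finset.range (N + 1), q.coeff c • (u ^ (N - c) * v ^ c)

open Polynomial in
theorem homogEval_mul_linear {A : Type*} [CommRing A] [Algebra ℂ A] (N : ℕ) (q : ℂ[X])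
    (hq : q.natDegree ≤ N) (α β : ℂ) (u v : A) :
    homogEval (N + 1) (q * (C α + C β * X)) u v = homogEval N q u v * (α • u + β • v) := by
  unfold homogEval
  have hz : q.coeff (N + 1) = 0 := coeff_eq_zero_of_natDegree_lt (by omega)
  have h1 : ∀ c, (q * (C α + C β * X)).coeff c
      = α * q.coeff c + β * (if c = 0 then 0 else q.coeff (c - 1)) := by
    intro c
    rw [mul_add, coeff_add, mul_comm q, coeff_C_mul, mul_comm q, mul_assoc, coeff_C_mul]
    cases c with
    | zero => simp
    | succ c => simp
  simp_rw [h1, add_smul, Finset.sum_add_distrib, mul_add, Finset.sum_mul]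
  congr 1
  · rw [Finset.sum_range_succ, hz]
    simp only [mul_zero, zero_smul, add_zero]
    refine Finset.sum_congr rfl fun c hc => ?_
    have : N + 1 - c = N - c + 1 := by have := Finset.mem_range.1 hc; omega
    rw [this, pow_succ]
    simp only [Algebra.smul_def, map_mul]
    ring
  · rw [Finset.sum_range_succ']
    simp only [Nat.add_eq_zero_iff, one_ne_zero, and_false, if_false, if_true, mul_zero, zero_smul,
      add_zero, Nat.add_sub_cancel, Nat.add_sub_add_right]
    refine Finset.sum_congr rfl fun c hc => ?_
    rw [pow_succ]
    simp only [Algebra.smul_def, map_mul]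
    ring

open Polynomial in
theorem natDegree_linear_pow_mul_le (α β γ δ : ℂ) (i j : ℕ) :
    ((C α + C β * X) ^ i * (C γ + C δ * X) ^ j : ℂ[X]).natDegree ≤ i + j := by
  have h : ∀ a b : ℂ, (C a + C b * X : ℂ[X]).natDegree ≤ 1 := by
    intro a b
    rw [add_comm]
    exact natDegree_linear_le
  refine natDegree_mul_le.trans (add_le_add ?_ ?_)
  · simpa using natDegree_pow_le_of_le i (h α β)
  · simpa using natDegree_pow_le_of_le j (h γ δ)

-- Rehomogenizing a product of linear factors is the same as substituting u, v for z₁, z₂ in it.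
-- With u, v the images of z₁, z₂ under a second matrix, this composes two substitutions.
open Polynomial in
theorem homogEval_pow_mul_pow {A : Type*} [CommRing A] [Algebra ℂ A] (α β γ δ : ℂ) (u v : A)
    (i j : ℕ) :
    homogEval (i + j) ((C α + C β * X) ^ i * (C γ + C δ * X) ^ j) u v
      = (α • u + β • v) ^ i * (γ • u + δ • v) ^ j := by
  induction j with
  | zero =>
    induction i with
    | zero => simp [homogEval]
    | succ i ih =>
      have := homogEval_mul_linear (A := A) i ((C α + C β * X) ^ i * (C γ + C δ * X) ^ 0)
        (natDegree_linear_pow_mul_le α β γ δ i 0) α β u v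
      simp only [pow_zero, mul_one, add_zero] at this ih ⊢
      rw [pow_succ, this, ih, pow_succ]
  | succ j ih =>
    have := homogEval_mul_linear (A := A) (i + j) ((C α + C β * X) ^ i * (C γ + C δ * X) ^ j)
      (natDegree_linear_pow_mul_le α β γ δ i j) γ δ u v
    rw [← add_assoc, pow_succ, ← mul_assoc, this, ih, pow_succ, ← mul_assoc]

open Polynomial in
/-- The image of the monomial `z₁ⁿ⁻ᵇ z₂ᵇ` under `g`, dehomogenized. -/
def spinPoly (n : ℕ) (g : Matrix (Fin 2) (Fin 2) ℂ) (b : ℕ) : ℂ[X] :=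
  (C (g 0 0) + C (g 1 0) * X) ^ (n - b) * (C (g 0 1) + C (g 1 1) * X) ^ b

open Polynomial in
theorem spinPoly_mul (n : ℕ) (g h : Matrix (Fin 2) (Fin 2) ℂ) {b : ℕ} (hb : b ≤ n) :
    spinPoly n (g * h) b
      = ∑ c ∈ Finset.range (n + 1), (spinPoly n h b).coeff c • spinPoly n g c := by
  have := homogEval_pow_mul_pow (A := ℂ[X]) (h 0 0) (h 1 0) (h 0 1) (h 1 1)
    (C (g 0 0) + C (g 1 0) * X) (C (g 0 1) + C (g 1 1) * X) (n - b) b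
  rw [Nat.sub_add_cancel hb] at this
  simp only [homogEval] at this
  simp only [spinPoly]
  rw [this]
  simp only [Matrix.mul_apply, Fin.sum_univ_two, smul_eq_C_mul, map_add, map_mul]
  ring

theorem spinRep_apply (n : ℕ) (g : Matrix (Fin 2) (Fin 2) ℂ) (a b : Fin (n + 1)) :
    spinRep n g a b = ((√(n.choose b : ℝ) / √(n.choose a : ℝ) : ℝ) : ℂ) *
      (spinPoly n g b).coeff a := rfl

theorem sqrt_choose_ne_zero {n : ℕ} (a : Fin (n + 1)) : √(n.choose a : ℝ) ≠ 0 := by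
  have : 0 < n.choose a := Nat.choose_pos (by omega)
  positivity

/-- The monomials compose by `spinPoly_mul`, and the binomial normalizations telescope through the
intermediate index. This holds for all 2×2 matrices, not only for unitary ones. -/
theorem spinRep_mul (n : ℕ) (g h : Matrix (Fin 2) (Fin 2) ℂ) :
    spinRep n (g * h) = spinRep n g * spinRep n h := by
  ext a b
  rw [Matrix.mul_apply, spinRep_apply, spinPoly_mul n g h (by omega : (b : ℕ) ≤ n),
    Polynomial.finsetSum_coeff, Finset.mul_sum, Finset.sum_range]
  refine Finset.sum_congr rfl fun c _ => ?_
  rw [spinRep_apply, spinRep_apply, Polynomial.coeff_smul, smul_eq_mul]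
  have h1 := sqrt_choose_ne_zero a
  have h2 := sqrt_choose_ne_zero c
  have h1' : ((√(n.choose a : ℝ) : ℝ) : ℂ) ≠ 0 := by exact_mod_cast h1
  have h2' : ((√(n.choose c : ℝ) : ℝ) : ℂ) ≠ 0 := by exact_mod_cast h2
  push_cast
  field_simp

theorem spinRep_one (n : ℕ) : spinRep n 1 = 1 := by
  ext a b
  rw [spinRep_apply]
  simp only [spinPoly, Matrix.one_apply_eq, ne_eq, one_ne_zero, not_false_eq_true,
    Matrix.one_apply_ne, zero_ne_one, map_one, map_zero, zero_mul, add_zero, one_pow, one_mul,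
    zero_add, Polynomial.coeff_X_pow]
  by_cases hab : a = b
  · subst hab
    simp [div_self (sqrt_choose_ne_zero a)]
  · rw [if_neg (fun h => hab (Fin.ext h)), Matrix.one_apply_ne hab, mul_zero]

/-! ### The action on operators -/

section Action

variable {n : ℕ}

theorem spinRep_inv_mul (U : SU2) :
    spinRep n ((U⁻¹ : SU2) : Matrix (Fin 2) (Fin 2) ℂ) * spinRep n (U : Matrix (Fin 2) (Fin 2) ℂ)
      = 1 := by
  rw [← spinRep_mul, ← Submonoid.coe_mul, inv_mul_cancel, Submonoid.coe_one, spinRep_one]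

theorem spinRep_mul_inv (U : SU2) :
    spinRep n (U : Matrix (Fin 2) (Fin 2) ℂ) * spinRep n ((U⁻¹ : SU2) : Matrix (Fin 2) (Fin 2) ℂ)
      = 1 := by
  rw [← spinRep_mul, ← Submonoid.coe_mul, mul_inv_cancel, Submonoid.coe_one, spinRep_one]

/-- The action of `U` on operators, as an algebra homomorphism. -/
def opActHom (U : SU2) : Op n →ₐ[ℂ] Op n :=
  AlgHom.ofLinearMap
    { toFun := opAct U
      map_add' := fun P Q => by
        change opAct U (P + Q) = opAct U P + opAct U Q
        simp only [opAct, mul_add, add_mul]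
      map_smul' := fun c P => by
        change opAct U (c • P) = c • opAct U P
        simp [opAct] }
    (by
      change opAct U 1 = 1
      simp [opAct, spinRep_mul_inv])
    (fun P Q => by
      change opAct U (P * Q) = opAct U P * opAct U Q
      simp only [opAct]
      calc _ = spinRep n (U : Matrix (Fin 2) (Fin 2) ℂ) * P * 1 * Q *
            spinRep n ((U⁻¹ : SU2) : Matrix (Fin 2) (Fin 2) ℂ) := by simp only [mul_one, mul_assoc]
        _ = _ := by rw [← spinRep_inv_mul U]; simp only [mul_assoc])

theorem opActHom_apply (U : SU2) (P : Op n) : opActHom U P = opAct U P := rfl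

theorem opAct_opAct (U V : SU2) (P : Op n) : opAct U (opAct V P) = opAct (U * V) P := by
  simp only [opAct, mul_inv_rev, Submonoid.coe_mul, spinRep_mul, mul_assoc]

theorem opAct_one (P : Op n) : opAct 1 P = P := by
  simp [opAct, spinRep_one]

theorem opAct_inv_opAct (U : SU2) (P : Op n) : opAct U⁻¹ (opAct U P) = P := by
  rw [opAct_opAct, inv_mul_cancel, opAct_one]

theorem trace_opAct (U : SU2) (P : Op n) : (opAct U P).trace = P.trace := by
  rw [opAct, Matrix.trace_mul_comm, ← mul_assoc, spinRep_inv_mul, one_mul]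

theorem trace_opAct_mul (U : SU2) (P Q : Op n) :
    (opAct U P * Q).trace = (P * opAct U⁻¹ Q).trace := by
  rw [← trace_opAct U⁻¹]
  simp only [← opActHom_apply, map_mul]
  simp only [opActHom_apply, opAct_inv_opAct]

end Action

/-! ### The derivative of `spinRep` at the identity -/

/-- Entrywise derivative at `0` of a curve of matrices. -/
def HasEntrywiseDeriv {ι κ : Type*} (M : ℝ → Matrix ι κ ℂ) (M' : Matrix ι κ ℂ) : Prop :=
  ∀ a b, HasDerivAt (fun t => M t a b) (M' a b) 0

theorem HasEntrywiseDeriv.mul {ι κ ρ : Type*} [Fintype κ] {M : ℝ → Matrix ι κ ℂ}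
    {M' : Matrix ι κ ℂ} {N : ℝ → Matrix κ ρ ℂ} {N' : Matrix κ ρ ℂ} (hM : HasEntrywiseDeriv M M')
    (hN : HasEntrywiseDeriv N N') :
    HasEntrywiseDeriv (fun t => M t * N t) (M' * N 0 + M 0 * N') := by
  intro a b
  simp only [Matrix.mul_apply, Matrix.add_apply, ← Finset.sum_add_distrib]
  exact HasDerivAt.fun_sum fun c _ => (hM a c).fun_mul (hN c b)

theorem HasEntrywiseDeriv.const {ι κ : Type*} (M : Matrix ι κ ℂ) :
    HasEntrywiseDeriv (fun _ => M) 0 := fun _ _ => hasDerivAt_const _ _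

theorem HasEntrywiseDeriv.unique {ι κ : Type*} {M : ℝ → Matrix ι κ ℂ} {M' M'' : Matrix ι κ ℂ}
    (h : HasEntrywiseDeriv M M') (h' : HasEntrywiseDeriv M M'') : M' = M'' := by
  ext a b
  exact (h a b).unique (h' a b)

open Polynomial in
/-- Coefficientwise derivative at `0` of a curve of polynomials. -/
def HasCoeffDeriv (F : ℝ → ℂ[X]) (F' : ℂ[X]) : Prop :=
  ∀ a, HasDerivAt (fun t => (F t).coeff a) (F'.coeff a) 0

open Polynomial in
theorem HasCoeffDeriv.mul {F G : ℝ → ℂ[X]} {F' G' : ℂ[X]} (hF : HasCoeffDeriv F F')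
    (hG : HasCoeffDeriv G G') :
    HasCoeffDeriv (fun t => F t * G t) (F' * G 0 + F 0 * G') := by
  intro a
  simp only [coeff_mul, coeff_add, ← Finset.sum_add_distrib]
  exact HasDerivAt.fun_sum fun c _ => (hF c.1).fun_mul (hG c.2)

open Polynomial in
theorem HasCoeffDeriv.pow {F : ℝ → ℂ[X]} {F' : ℂ[X]} (hF : HasCoeffDeriv F F') (k : ℕ) :
    HasCoeffDeriv (fun t => F t ^ k) (k * F 0 ^ (k - 1) * F') := by
  induction k with
  | zero =>
    intro a
    simpa using hasDerivAt_const (0 : ℝ) ((1 : ℂ[X]).coeff a)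
  | succ k ih =>
    have := ih.mul hF
    simp only [← pow_succ] at this
    convert this using 1
    rcases k with _ | k
    · simp
    · simp only [Nat.add_sub_cancel, pow_succ]
      push_cast
      ring

open Polynomial in
theorem hasCoeffDeriv_linear {f g : ℝ → ℂ} {f' g' : ℂ} (hf : HasDerivAt f f' 0)
    (hg : HasDerivAt g g' 0) :
    HasCoeffDeriv (fun t => C (f t) + C (g t) * X) (C f' + C g' * X) := by
  intro a
  rcases a with _ | _ | a
  · simpa using hf
  · simpa [coeff_C] using hg
  · simpa [coeff_C, coeff_X] using hasDerivAt_const (0 : ℝ) (0 : ℂ)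

/-- The diagonal operator `J₃`. -/
def Jthree (n : ℕ) : Op n := Matrix.diagonal fun a => (((n : ℝ) / 2 - (a : ℕ) : ℝ) : ℂ)

/-- The derivative of `spinRep` at the identity. -/
def spinDeriv (n : ℕ) (X : Matrix (Fin 2) (Fin 2) ℂ) : Op n :=
  X 1 0 • Jminus n + X 0 1 • Jplus n + (X 0 0 - X 1 1) • Jthree n
    + ((X 0 0 + X 1 1) * n / 2) • (1 : Op n)

/-- The normalization √(n choose k) of the monomials turns the coefficient n - b of the derivation
z₁ ↦ z₂ into the entry of J₋; `sqrt_choose_pred` does the same for z₂ ↦ z₁ and J₊. -/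
theorem sqrt_choose_succ (n b : ℕ) (hb : b + 1 ≤ n) :
    √(n.choose b : ℝ) / √(n.choose (b + 1) : ℝ) * ((n : ℝ) - b) = √(((n : ℝ) - b) * (b + 1)) := by
  have h1 : (n.choose (b + 1) : ℝ) * (b + 1) = n.choose b * ((n : ℝ) - b) := by
    have := Nat.choose_succ_right_eq n b
    rw [← Nat.cast_sub (by omega : b ≤ n)]
    exact_mod_cast this
  have hnb : (0 : ℝ) < (n : ℝ) - b := by
    have : ((b + 1 : ℕ) : ℝ) ≤ n := by exact_mod_cast hb
    push_cast at this
    linarith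
  have hc : (0 : ℝ) < n.choose (b + 1) := by exact_mod_cast Nat.choose_pos hb
  have hc0 : (0 : ℝ) < n.choose b := by exact_mod_cast Nat.choose_pos (by omega)
  have hb1 : (0 : ℝ) < (b : ℝ) + 1 := by positivity
  rw [eq_comm, Real.sqrt_eq_iff_mul_self_eq (by positivity) (by positivity), ← sq, mul_pow,
    div_pow, Real.sq_sqrt hc0.le, Real.sq_sqrt hc.le]
  field_simp
  nlinarith

theorem sqrt_choose_pred (n a : ℕ) (ha : a + 1 ≤ n) :
    √(n.choose (a + 1) : ℝ) / √(n.choose a : ℝ) * ((a : ℝ) + 1) = √(((n : ℝ) - a) * (a + 1)) := by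
  have h := sqrt_choose_succ n a ha
  have h1 : (n.choose (a + 1) : ℝ) * (a + 1) = n.choose a * ((n : ℝ) - a) := by
    have := Nat.choose_succ_right_eq n a
    rw [← Nat.cast_sub (by omega : a ≤ n)]
    exact_mod_cast this
  have hc : (0 : ℝ) < n.choose (a + 1) := by exact_mod_cast Nat.choose_pos ha
  have hc0 : (0 : ℝ) < n.choose a := by exact_mod_cast Nat.choose_pos (by omega)
  rw [← h, div_mul_eq_mul_div, div_mul_eq_mul_div, div_eq_div_iff (by positivity) (by positivity)]
  have e1 := Real.mul_self_sqrt hc.le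
  have e2 := Real.mul_self_sqrt hc0.le
  linear_combination ((a : ℝ) + 1) * e1 - ((n : ℝ) - a) * e2 + h1

open Polynomial in
theorem spinRep_hasEntrywiseDeriv (n : ℕ) {g : ℝ → Matrix (Fin 2) (Fin 2) ℂ}
    {X : Matrix (Fin 2) (Fin 2) ℂ} (hg : HasEntrywiseDeriv g X) (h0 : g 0 = 1) :
    HasEntrywiseDeriv (fun t => spinRep n (g t)) (spinDeriv n X) := by
  intro a b
  have h := ((hasCoeffDeriv_linear (hg 0 0) (hg 1 0)).pow (n - b)).mul
    ((hasCoeffDeriv_linear (hg 0 1) (hg 1 1)).pow b) a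
  simp only [spinRep_apply]
  refine (h.const_mul ((√(n.choose b : ℝ) / √(n.choose a : ℝ) : ℝ) : ℂ)).congr_deriv ?_
  have hb : (b : ℕ) ≤ n := by omega
  have hba := sqrt_choose_ne_zero a
  simp only [h0, Matrix.one_apply_eq, ne_eq, one_ne_zero, zero_ne_one, not_false_eq_true,
    Matrix.one_apply_ne, map_one, map_zero, zero_mul, add_zero, one_pow, one_mul, zero_add, mul_one]
  -- To first order z₁ and z₂ each change by a linear form, so the monomial of index b only reaches
  -- the indices b - 1, b and b + 1.
  have expand : (((n - (b : ℕ) : ℕ) : ℂ[X]) * (C (X 0 0) + C (X 1 0) * Polynomial.X)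
      * Polynomial.X ^ (b : ℕ) + ((b : ℕ) : ℂ[X]) * Polynomial.X ^ ((b : ℕ) - 1)
      * (C (X 0 1) + C (X 1 1) * Polynomial.X)).coeff a
      = (if (a : ℕ) = b then ((n : ℂ) - (b : ℕ)) * X 0 0 + (b : ℕ) * X 1 1 else 0)
        + (if (a : ℕ) = b + 1 then ((n : ℂ) - (b : ℕ)) * X 1 0 else 0)
        + (if (a : ℕ) + 1 = b then (b : ℂ) * X 0 1 else 0) := by
    -- For b = 0 the exponent b - 1 is truncated, but its coefficient b vanishes.
    rcases hbb : (b : ℕ) with _ | k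
    · have e1 : (((n - 0 : ℕ) : ℂ[X]) * (C (X 0 0) + C (X 1 0) * Polynomial.X)
          * Polynomial.X ^ 0 + ((0 : ℕ) : ℂ[X]) * Polynomial.X ^ (0 - 1)
          * (C (X 0 1) + C (X 1 1) * Polynomial.X))
          = C ((n : ℂ) * X 0 0) * Polynomial.X ^ 0 + C ((n : ℂ) * X 1 0) * Polynomial.X ^ 1 := by
        simp
        ring
      rw [e1, coeff_add, coeff_C_mul, coeff_C_mul, coeff_X_pow, coeff_X_pow]
      simp
    · have e1 : (((n - (k + 1) : ℕ) : ℂ[X]) * (C (X 0 0) + C (X 1 0) * Polynomial.X)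
          * Polynomial.X ^ (k + 1) + ((k + 1 : ℕ) : ℂ[X]) * Polynomial.X ^ (k + 1 - 1)
          * (C (X 0 1) + C (X 1 1) * Polynomial.X))
          = C (((n - (k + 1) : ℕ) : ℂ) * X 0 0 + ((k + 1 : ℕ) : ℂ) * X 1 1)
              * Polynomial.X ^ (k + 1)
            + C (((n - (k + 1) : ℕ) : ℂ) * X 1 0) * Polynomial.X ^ (k + 1 + 1)
            + C (((k + 1 : ℕ) : ℂ) * X 0 1) * Polynomial.X ^ k := by
        simp only [map_add, map_mul, map_natCast, Nat.add_sub_cancel]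
        ring
      rw [e1, coeff_add, coeff_add, coeff_C_mul, coeff_C_mul, coeff_C_mul, coeff_X_pow, coeff_X_pow,
        coeff_X_pow, Nat.cast_sub (by omega : k + 1 ≤ n)]
      simp
  rw [expand]
  simp only [spinDeriv, Matrix.add_apply, Matrix.smul_apply, Jminus, Jplus, Jthree,
    Matrix.transpose_apply, Matrix.diagonal_apply, Matrix.one_apply, smul_eq_mul, Fin.ext_iff]
  by_cases h1 : (a : ℕ) = b
  · have : a = b := Fin.ext h1
    subst this
    simp [hba]
    ring
  · by_cases h2 : (a : ℕ) = b + 1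
    · have h3 : ¬ (b : ℕ) = a + 1 := by omega
      have h4 : ¬ (a : ℕ) + 1 = b := by omega
      rw [if_neg h1, if_neg h1, if_neg h3, if_neg h4, if_pos h2, if_pos h2, h2]
      have := sqrt_choose_succ n b (by omega)
      rw [← this]
      simp
      ring
    · by_cases h3 : (b : ℕ) = a + 1
      · have h4 : (a : ℕ) + 1 = b := by omega
        rw [if_neg h1, if_neg h1, if_neg h2, if_neg h2, if_pos h3, if_pos h4, h3]
        have := sqrt_choose_pred n a (by omega)
        rw [← this]
        simp
        ring
      · have h4 : ¬ (a : ℕ) + 1 = b := by omega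
        simp [h1, h2, h3, h4]

/-- Differentiate φ(U(1 + tX)U⁻¹) = φ(U) φ(1 + tX) φ(U⁻¹) at t = 0. The curve 1 + tX leaves SU(2),
which is harmless because `spinRep` is multiplicative on all matrices. -/
theorem opAct_spinDeriv (n : ℕ) (U : SU2) (X : Matrix (Fin 2) (Fin 2) ℂ) :
    opAct U (spinDeriv n X) = spinDeriv n
      ((U : Matrix (Fin 2) (Fin 2) ℂ) * X * ((U⁻¹ : SU2) : Matrix (Fin 2) (Fin 2) ℂ)) := by
  have hlin : ∀ Y : Matrix (Fin 2) (Fin 2) ℂ,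
      HasEntrywiseDeriv (fun t : ℝ => 1 + (t : ℂ) • Y) Y := by
    intro Y a b
    have h1 : HasDerivAt (fun t : ℝ => (t : ℂ)) 1 0 := Complex.ofRealCLM.hasDerivAt
    simpa using (h1.mul_const (Y a b)).const_add ((1 : Matrix (Fin 2) (Fin 2) ℂ) a b)
  have h1 := spinRep_hasEntrywiseDeriv n (hlin X) (by simp)
  have h2 := spinRep_hasEntrywiseDeriv n (hlin ((U : Matrix (Fin 2) (Fin 2) ℂ) * X *
    ((U⁻¹ : SU2) : Matrix (Fin 2) (Fin 2) ℂ))) (by simp)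
  have h3 := ((HasEntrywiseDeriv.const (spinRep n (U : Matrix (Fin 2) (Fin 2) ℂ))).mul h1).mul
    (HasEntrywiseDeriv.const (spinRep n ((U⁻¹ : SU2) : Matrix (Fin 2) (Fin 2) ℂ)))
  refine HasEntrywiseDeriv.unique ?_ h2
  convert h3 using 1
  · ext t : 1
    rw [← spinRep_mul, ← spinRep_mul]
    congr 1
    simp only [mul_add, add_mul, mul_one, Matrix.mul_smul, Matrix.smul_mul]
    rw [← Submonoid.coe_mul, mul_inv_cancel, Submonoid.coe_one]
  · simp [opAct]

/-- The operator `v · J = v₁ J₁ + v₂ J₂ + v₃ J₃`. -/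
def spinDot (n : ℕ) (v : Fin 3 → ℝ) : Op n :=
  (((v 0 : ℂ) + v 1 * Complex.I) / 2) • Jminus n + (((v 0 : ℂ) - v 1 * Complex.I) / 2) • Jplus n
    + (v 2 : ℂ) • Jthree n

theorem spinDot_eq_spinDeriv (n : ℕ) (v : Fin 3 → ℝ) :
    spinDot n v = (1 / 2 : ℂ) • spinDeriv n (pauliDot v) := by
  simp only [spinDot, spinDeriv, pauliDot]
  simp
  module

/-- Angular momentum is a vector operator: v·J is half the derivative of the representation at v·σ,
and the covering map is defined by conjugation of v·σ. -/
theorem opAct_spinDot (n : ℕ) {U : SU2} {R : SO3} (h : Covers U R) (v : Fin 3 → ℝ) :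
    opAct U (spinDot n v) = spinDot n ((R : Matrix (Fin 3) (Fin 3) ℝ) *ᵥ v) := by
  rw [spinDot_eq_spinDeriv, spinDot_eq_spinDeriv, ← h v, ← opAct_spinDeriv, ← opActHom_apply,
    map_smul, opActHom_apply]

/-! ### Commutation relations -/

section Bracket

variable {n : ℕ} (A A' P Q : Op n) (c : ℂ)

theorem commutator_smul : ⁅A, c • P⁆ = c • ⁅A, P⁆ := by
  simp only [Ring.lie_def, Matrix.mul_smul, Matrix.smul_mul, smul_sub]

theorem smul_commutator : ⁅c • A, P⁆ = c • ⁅A, P⁆ := by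
  simp only [Ring.lie_def, Matrix.mul_smul, Matrix.smul_mul, smul_sub]

theorem commutator_zero : ⁅A, (0 : Op n)⁆ = 0 := by
  simp [Ring.lie_def]

theorem neg_commutator : ⁅-A, P⁆ = -⁅A, P⁆ := by
  simp only [Ring.lie_def]
  noncomm_ring

theorem commutator_add : ⁅A, P + Q⁆ = ⁅A, P⁆ + ⁅A, Q⁆ := by
  simp only [Ring.lie_def]
  noncomm_ring

theorem add_commutator : ⁅A + A', P⁆ = ⁅A, P⁆ + ⁅A', P⁆ := by
  simp only [Ring.lie_def]
  noncomm_ring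

theorem commutator_jacobi : ⁅A, ⁅A', P⁆⁆ = ⁅⁅A, A'⁆, P⁆ + ⁅A', ⁅A, P⁆⁆ := by
  simp only [Ring.lie_def]
  noncomm_ring

end Bracket

section Commutators

variable {n : ℕ}

theorem Jminus_apply (a b : Fin (n + 1)) : Jminus n a b =
    if (a : ℕ) = (b : ℕ) + 1 then ((√(((n : ℝ) - (b : ℕ)) * ((b : ℕ) + 1)) : ℝ) : ℂ) else 0 := rfl

theorem Jplus_apply (a b : Fin (n + 1)) : Jplus n a b =
    if (b : ℕ) = (a : ℕ) + 1 then ((√(((n : ℝ) - (a : ℕ)) * ((a : ℕ) + 1)) : ℝ) : ℂ) else 0 := rfl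

theorem conjTranspose_Jminus : (Jminus n)ᴴ = Jplus n := by
  ext a b
  rw [Matrix.conjTranspose_apply, Jminus_apply, Jplus_apply]
  split_ifs <;> simp

theorem conjTranspose_Jplus : (Jplus n)ᴴ = Jminus n := by
  rw [← conjTranspose_Jminus, Matrix.conjTranspose_conjTranspose]

theorem conjTranspose_Jthree : (Jthree n)ᴴ = Jthree n := by
  rw [Jthree, Matrix.diagonal_conjTranspose]
  congr 1
  ext a
  simp

theorem lie_Jthree_apply (P : Op n) (a b : Fin (n + 1)) :
    ⁅Jthree n, P⁆ a b = ((b : ℕ) - (a : ℕ) : ℂ) * P a b := by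
  rw [Ring.lie_def, Matrix.sub_apply, Jthree, Matrix.diagonal_mul, Matrix.mul_diagonal]
  push_cast
  ring

theorem lie_Jthree_Jplus : ⁅Jthree n, Jplus n⁆ = Jplus n := by
  ext a b
  rw [lie_Jthree_apply, Jplus_apply]
  split_ifs with h
  · rw [h]
    push_cast
    ring
  · simp

theorem lie_Jthree_Jminus : ⁅Jthree n, Jminus n⁆ = -Jminus n := by
  ext a b
  rw [lie_Jthree_apply, Matrix.neg_apply, Jminus_apply]
  split_ifs with h
  · rw [h]
    push_cast
    ring
  · simp

theorem Jplus_mul_Jminus : Jplus n * Jminus n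
    = Matrix.diagonal fun a : Fin (n + 1) => (((n : ℝ) - (a : ℕ)) * ((a : ℕ) + 1) : ℂ) := by
  ext a b
  rw [Matrix.mul_apply, Matrix.diagonal_apply]
  simp only [Jplus_apply, Jminus_apply]
  have hsq : (0 : ℝ) ≤ ((n : ℝ) - (a : ℕ)) * ((a : ℕ) + 1) := by
    have : ((a : ℕ) : ℝ) ≤ n := by exact_mod_cast (by omega : (a : ℕ) ≤ n)
    exact mul_nonneg (by linarith) (by positivity)
  by_cases hab : a = b
  · subst hab
    rw [if_pos rfl]
    -- At a = n there is no intermediate state, in agreement with the vanishing factor n - a.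
    by_cases ha : (a : ℕ) + 1 ≤ n
    · rw [Finset.sum_eq_single ⟨(a : ℕ) + 1, by omega⟩]
      · simp only [if_true]
        rw [← Complex.ofReal_mul, Real.mul_self_sqrt hsq]
        push_cast
        ring
      · intro c _ hc
        rw [if_neg (fun h => hc (Fin.ext h)), zero_mul]
      · simp
    · rw [Finset.sum_eq_zero]
      · have : (a : ℕ) = n := by omega
        simp [this]
      · intro c _
        rw [if_neg (by omega), zero_mul]
  · rw [if_neg hab]
    refine Finset.sum_eq_zero fun c _ => ?_
    by_cases h : (c : ℕ) = a + 1
    · rw [if_neg (c := (c : ℕ) = b + 1) (fun h' => hab (Fin.ext (by omega))), mul_zero]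
    · rw [if_neg h, zero_mul]

theorem Jminus_mul_Jplus : Jminus n * Jplus n
    = Matrix.diagonal fun a : Fin (n + 1) => (((n : ℝ) - (a : ℕ) + 1) * (a : ℕ) : ℂ) := by
  ext a b
  rw [Matrix.mul_apply, Matrix.diagonal_apply]
  simp only [Jplus_apply, Jminus_apply]
  by_cases hab : a = b
  · subst hab
    rw [if_pos rfl]
    by_cases ha : (a : ℕ) = 0
    · rw [Finset.sum_eq_zero]
      · simp [ha]
      · intro c _
        rw [if_neg (by omega), zero_mul]
    · have hsq : (0 : ℝ) ≤ ((n : ℝ) - ((a : ℕ) - 1 : ℕ)) * (((a : ℕ) - 1 : ℕ) + 1) := by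
        have : (((a : ℕ) - 1 : ℕ) : ℝ) ≤ n := by exact_mod_cast (by omega : (a : ℕ) - 1 ≤ n)
        exact mul_nonneg (by linarith) (by positivity)
      rw [Finset.sum_eq_single ⟨(a : ℕ) - 1, by omega⟩]
      · have : (a : ℕ) = a - 1 + 1 := by omega
        simp only [← this, if_true]
        rw [← Complex.ofReal_mul, Real.mul_self_sqrt hsq, Nat.cast_sub (by omega)]
        push_cast
        ring
      · intro c _ hc
        rw [if_neg (fun h => hc (Fin.ext (by simp; omega))), zero_mul]
      · simp
  · rw [if_neg hab]
    refine Finset.sum_eq_zero fun c _ => ?_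
    by_cases h : (a : ℕ) = c + 1
    · rw [if_neg (c := (b : ℕ) = c + 1) (fun h' => hab (Fin.ext (by omega))), mul_zero]
    · rw [if_neg h, zero_mul]

theorem lie_Jplus_Jminus : ⁅Jplus n, Jminus n⁆ = (2 : ℂ) • Jthree n := by
  rw [Ring.lie_def, Jplus_mul_Jminus, Jminus_mul_Jplus, Jthree, Matrix.diagonal_sub,
    ← Matrix.diagonal_smul]
  congr 1
  ext a
  simp
  ring

theorem lie_Jplus_pow (l : ℕ) : ⁅Jplus n, Jplus n ^ l⁆ = 0 := by
  rw [Ring.lie_def, (Commute.self_pow (Jplus n) l).eq, sub_self]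

theorem lie_Jthree_Jplus_pow (l : ℕ) : ⁅Jthree n, Jplus n ^ l⁆ = (l : ℂ) • Jplus n ^ l := by
  induction l with
  | zero => simp [Ring.lie_def]
  | succ l ih =>
    have h : ⁅Jthree n, Jplus n ^ l * Jplus n⁆
        = ⁅Jthree n, Jplus n ^ l⁆ * Jplus n + Jplus n ^ l * ⁅Jthree n, Jplus n⁆ := by
      simp only [Ring.lie_def]
      noncomm_ring
    rw [pow_succ, h, ih, lie_Jthree_Jplus, Matrix.smul_mul]
    push_cast
    module

/-- A single path of l unit steps joins the two indices, so the entry is a product of l nonzero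
matrix elements. This makes `mu n l` nonzero. -/
theorem Jplus_pow_apply_ne_zero (l : ℕ) (hl : l ≤ n) :
    (Jplus n ^ l) 0 ⟨l, Nat.lt_succ_of_le hl⟩ ≠ 0 := by
  induction l with
  | zero =>
    rw [pow_zero]
    exact one_ne_zero
  | succ l ih =>
    have h := ih (by omega)
    rw [pow_succ, Matrix.mul_apply, Finset.sum_eq_single ⟨l, by omega⟩]
    · refine mul_ne_zero h ?_
      rw [Jplus_apply, if_pos rfl, Complex.ofReal_ne_zero]
      have : ((l + 1 : ℕ) : ℝ) ≤ n := by exact_mod_cast hl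
      push_cast at this
      have h2 : (0 : ℝ) < n - l := by linarith
      have h3 : (0 : ℝ) < (l : ℝ) + 1 := by positivity
      exact (Real.sqrt_pos.2 (mul_pos h2 h3)).ne'
    · intro c _ hc
      rw [Jplus_apply, if_neg, mul_zero]
      intro h'
      exact hc (Fin.ext (by simp at h' ⊢; omega))
    · simp

end Commutators

/-! ### Invariant sesquilinear forms -/

section Forms

variable {n : ℕ}

theorem hsInner_self (P : Op n) :
    hsInner P P = ((∑ b, ∑ a, Complex.normSq (P a b) : ℝ) : ℂ) := by
  simp only [hsInner, Matrix.trace, Matrix.diag_apply, Matrix.mul_apply, Matrix.conjTranspose_apply]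
  push_cast
  refine Finset.sum_congr rfl fun b _ => Finset.sum_congr rfl fun a _ => ?_
  rw [Complex.normSq_eq_conj_mul_self]
  rfl

theorem hsInner_self_re_pos {P : Op n} (hP : P ≠ 0) : 0 < (hsInner P P).re := by
  rw [hsInner_self, Complex.ofReal_re]
  by_contra! h
  refine hP ?_
  have h0 := le_antisymm h
    (Finset.sum_nonneg fun b _ => Finset.sum_nonneg fun a _ => Complex.normSq_nonneg (P a b))
  rw [Finset.sum_eq_zero_iff_of_nonneg
    (fun b _ => Finset.sum_nonneg fun a _ => Complex.normSq_nonneg (P a b))] at h0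
  ext a b
  have h1 := (Finset.sum_eq_zero_iff_of_nonneg (fun a _ => Complex.normSq_nonneg (P a b))).1
    (h0 b (Finset.mem_univ _)) a (Finset.mem_univ _)
  simpa using h1

theorem hsInner_conj (P Q : Op n) : conj (hsInner P Q) = hsInner Q P := by
  simp only [hsInner]
  rw [← Matrix.conjTranspose_conjTranspose Q, ← Matrix.conjTranspose_mul,
    Matrix.trace_conjTranspose, Matrix.conjTranspose_conjTranspose]
  simp

/-- The Hilbert-Schmidt inner product as a sesquilinear form. -/
def hsForm (n : ℕ) : Op n →ₗ⋆[ℂ] Op n →ₗ[ℂ] ℂ :=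
  LinearMap.mk₂'ₛₗ (starRingEnd ℂ) (RingHom.id ℂ) hsInner
    (fun P P' Q => by simp [hsInner, add_mul])
    (fun c P Q => by simp [hsInner])
    (fun P Q Q' => by simp [hsInner, mul_add])
    (fun c P Q => by simp [hsInner])

theorem hsForm_apply (P Q : Op n) : hsForm n P Q = hsInner P Q := rfl

/-- A sesquilinear form on operators that is invariant under the adjoint action of the
angular momentum operators. -/
structure IsAdInvariant (B : Op n →ₗ⋆[ℂ] Op n →ₗ[ℂ] ℂ) : Prop where
  lie_Jplus : ∀ P Q, B ⁅Jplus n, P⁆ Q = B P ⁅Jminus n, Q⁆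
  lie_Jminus : ∀ P Q, B ⁅Jminus n, P⁆ Q = B P ⁅Jplus n, Q⁆
  lie_Jthree : ∀ P Q, B ⁅Jthree n, P⁆ Q = B P ⁅Jthree n, Q⁆

theorem hsInner_lie (A P Q : Op n) : hsInner ⁅A, P⁆ Q = hsInner P ⁅Aᴴ, Q⁆ := by
  simp only [hsInner, Ring.lie_def, Matrix.conjTranspose_sub, Matrix.conjTranspose_mul, sub_mul,
    mul_sub, Matrix.trace_sub]
  congr 1
  · rw [mul_assoc]
  · rw [mul_assoc, Matrix.trace_mul_comm, mul_assoc]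

theorem isAdInvariant_hsForm : IsAdInvariant (hsForm n) where
  lie_Jplus P Q := by rw [hsForm_apply, hsInner_lie, conjTranspose_Jplus, hsForm_apply]
  lie_Jminus P Q := by rw [hsForm_apply, hsInner_lie, conjTranspose_Jminus, hsForm_apply]
  lie_Jthree P Q := by rw [hsForm_apply, hsInner_lie, conjTranspose_Jthree, hsForm_apply]

/-- The Casimir operator of the adjoint action. -/
def casimir (P : Op n) : Op n :=
  ⁅Jminus n, ⁅Jplus n, P⁆⁆ + ⁅Jthree n, ⁅Jthree n, P⁆⁆ + ⁅Jthree n, P⁆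

/-- Each summand of the Casimir operator is symmetric by itself, since J₋ and J₊ are adjoint to each
other and J₃ is self-adjoint for the form. -/
theorem IsAdInvariant.casimir {B : Op n →ₗ⋆[ℂ] Op n →ₗ[ℂ] ℂ} (hB : IsAdInvariant B) (P Q : Op n) :
    B (casimir P) Q = B P (SpinSystem.casimir Q) := by
  simp only [SpinSystem.casimir, map_add, LinearMap.add_apply, hB.lie_Jplus, hB.lie_Jminus,
    hB.lie_Jthree]

end Forms

/-! ### The coupled basis -/

section Basis

variable {n : ℕ}

theorem sqrt_beta_pos {l k : ℕ} (hk : k < 2 * l) : 0 < √((2 * (l : ℝ) - k) * (k + 1)) := by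
  have : (k : ℝ) < 2 * l := by exact_mod_cast hk
  exact Real.sqrt_pos.2 (mul_pos (by linarith) (by positivity))

theorem sqrt_beta_mul_self {l k : ℕ} (hk : k < 2 * l) :
    ((√((2 * (l : ℝ) - k) * (k + 1)) : ℝ) : ℂ) * ((√((2 * (l : ℝ) - k) * (k + 1)) : ℝ) : ℂ)
      = (2 * (l : ℂ) - k) * (k + 1) := by
  have : (k : ℝ) < 2 * l := by exact_mod_cast hk
  rw [← Complex.ofReal_mul, Real.mul_self_sqrt (mul_nonneg (by linarith) (by positivity))]
  push_cast
  ring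

/-- At k = 2l the coefficient is zero, and `basisAux n l (2 * l + 1)` is zero through division by
zero. The formula would then say that J₋ kills the lowest vector, a fact that is never needed: the
Casimir operator is written with J₊ acting first. -/
theorem lie_Jminus_basisAux {l k : ℕ} (hk : k < 2 * l) :
    ⁅Jminus n, basisAux n l k⁆
      = ((√((2 * (l : ℝ) - k) * (k + 1)) : ℝ) : ℂ) • basisAux n l (k + 1) := by
  rw [basisAux, Ring.lie_def, smul_smul, ← Complex.ofReal_mul,
    mul_one_div_cancel (sqrt_beta_pos hk).ne', Complex.ofReal_one, one_smul]

theorem lie_Jthree_basisAux (l k : ℕ) :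
    ⁅Jthree n, basisAux n l k⁆ = ((l : ℂ) - k) • basisAux n l k := by
  induction k with
  | zero => rw [basisAux, commutator_smul, lie_Jthree_Jplus_pow, smul_comm]; simp
  | succ k ih =>
    rw [basisAux, ← Ring.lie_def, commutator_smul, commutator_jacobi, lie_Jthree_Jminus, ih, commutator_smul, neg_commutator]
    push_cast
    module

theorem lie_Jplus_basisAux_zero (l : ℕ) : ⁅Jplus n, basisAux n l 0⁆ = 0 := by
  rw [basisAux, commutator_smul, lie_Jplus_pow, smul_zero]

theorem lie_Jplus_basisAux_succ {l k : ℕ} (hk : k < 2 * l) :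
    ⁅Jplus n, basisAux n l (k + 1)⁆
      = ((√((2 * (l : ℝ) - k) * (k + 1)) : ℝ) : ℂ) • basisAux n l k := by
  -- By [J₊, J₋] = 2J₃, the eigenvalue of J₊J₋ at level k is that of J₋J₊ plus 2(l - k), and (2l - k
  -- + 1)k + 2(l - k) = (2l - k)(k + 1). The induction supplies the eigenvalue of J₋J₊ from the
  -- level above.
  have key : ∀ k, k < 2 * l → ⁅Jminus n, ⁅Jplus n, basisAux n l k⁆⁆
        = ((2 * (l : ℂ) - k + 1) * k) • basisAux n l k →
      ⁅Jplus n, basisAux n l (k + 1)⁆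
        = ((√((2 * (l : ℝ) - k) * (k + 1)) : ℝ) : ℂ) • basisAux n l k := by
    intro k hk h
    have hβ := sqrt_beta_mul_self hk
    have hβ0 : ((√((2 * (l : ℝ) - k) * (k + 1)) : ℝ) : ℂ) ≠ 0 := by
      exact_mod_cast (sqrt_beta_pos hk).ne'
    have h1 : ((√((2 * (l : ℝ) - k) * (k + 1)) : ℝ) : ℂ) • ⁅Jplus n, basisAux n l (k + 1)⁆
        = ((2 * (l : ℂ) - k) * (k + 1)) • basisAux n l k := by
      rw [← commutator_smul, ← lie_Jminus_basisAux hk, commutator_jacobi, lie_Jplus_Jminus, smul_commutator,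
        lie_Jthree_basisAux, h]
      module
    rw [← hβ, ← smul_smul] at h1
    exact smul_right_injective _ hβ0 h1
  induction k with
  | zero => exact key 0 hk (by simp [lie_Jplus_basisAux_zero, commutator_zero])
  | succ k ih =>
    refine key _ hk ?_
    rw [ih (by omega), commutator_smul, lie_Jminus_basisAux (by omega), smul_smul,
      sqrt_beta_mul_self (by omega)]
    push_cast
    congr 1
    ring

theorem casimir_basisAux {l k : ℕ} (hk : k ≤ 2 * l) :
    casimir (basisAux n l k) = ((l : ℂ) * (l + 1)) • basisAux n l k := by
  rw [casimir, lie_Jthree_basisAux, commutator_smul, lie_Jthree_basisAux]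
  rcases k with _ | k
  · rw [lie_Jplus_basisAux_zero, commutator_zero]
    push_cast
    module
  · rw [lie_Jplus_basisAux_succ (by omega), commutator_smul, lie_Jminus_basisAux (by omega), smul_smul,
      sqrt_beta_mul_self (by omega)]
    push_cast
    module

theorem mu_pos {l : ℕ} (hl : l ≤ n) : 0 < mu n l := by
  have h : Jminus n ^ l * Jplus n ^ l = (Jplus n ^ l)ᴴ * Jplus n ^ l := by
    rw [Matrix.conjTranspose_pow, conjTranspose_Jplus]
  rw [mu, h]
  refine Real.sqrt_pos.2 (hsInner_self_re_pos fun h0 => Jplus_pow_apply_ne_zero l hl ?_)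
  rw [h0]
  rfl

theorem hsInner_basisAux_zero {l : ℕ} (hl : l ≤ n) :
    hsInner (basisAux n l 0) (basisAux n l 0) = 1 := by
  have h : Jminus n ^ l * Jplus n ^ l = (Jplus n ^ l)ᴴ * Jplus n ^ l := by
    rw [Matrix.conjTranspose_pow, conjTranspose_Jplus]
  have hmu := mu_pos hl
  have h1 : hsInner (Jplus n ^ l) (Jplus n ^ l) = ((mu n l ^ 2 : ℝ) : ℂ) := by
    have h2 : (hsInner (Jplus n ^ l) (Jplus n ^ l)).re = mu n l ^ 2 := by
      rw [mu, h, Real.sq_sqrt]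
      · rfl
      -- A negative radicand would make `mu` zero, by the default value of the square root.
      · by_contra! hneg
        rw [mu, h, Real.sqrt_eq_zero_of_nonpos hneg.le] at hmu
        exact lt_irrefl _ hmu
    rw [← h2, hsInner_self, Complex.ofReal_re]
  have hmu' : ((mu n l : ℝ) : ℂ) ≠ 0 := by exact_mod_cast hmu.ne'
  rw [basisAux, ← hsForm_apply, map_smul, map_smulₛₗ, LinearMap.smul_apply, hsForm_apply, h1,
    Complex.conj_ofReal, smul_eq_mul, smul_eq_mul]
  push_cast
  field_simp
  rw [← pow_mul, mul_comm, pow_mul]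
  simp

/-- J₋ and J₊ are adjoint and link consecutive levels with the same nonzero coefficient, so the
diagonal value passes from one level to the next. -/
theorem IsAdInvariant.basisAux_same {B : Op n →ₗ⋆[ℂ] Op n →ₗ[ℂ] ℂ} (hB : IsAdInvariant B)
    {l k : ℕ} (hk : k ≤ 2 * l) :
    B (basisAux n l k) (basisAux n l k) = B (basisAux n l 0) (basisAux n l 0) := by
  induction k with
  | zero => rfl
  | succ k ih =>
    rw [← ih (by omega)]
    have h := hB.lie_Jminus (basisAux n l k) (basisAux n l (k + 1))
    rw [lie_Jminus_basisAux (by omega), lie_Jplus_basisAux_succ (by omega), map_smulₛₗ,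
      LinearMap.smul_apply, map_smul, Complex.conj_ofReal] at h
    exact smul_right_injective _ (by exact_mod_cast (sqrt_beta_pos (by omega : k < 2 * l)).ne') h

/-- Eigenvectors for different eigenvalues are orthogonal: J₃ separates the levels for equal l, and
the Casimir operator separates l from l', its eigenvalues differing by (l - l')(l + l' + 1). -/
theorem IsAdInvariant.basisAux_eq_zero {B : Op n →ₗ⋆[ℂ] Op n →ₗ[ℂ] ℂ} (hB : IsAdInvariant B)
    {l k l' k' : ℕ} (hk : k ≤ 2 * l) (hk' : k' ≤ 2 * l') (h : ¬ (l = l' ∧ k = k')) :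
    B (basisAux n l k) (basisAux n l' k') = 0 := by
  by_cases hl : l = l'
  · subst hl
    have h1 := hB.lie_Jthree (basisAux n l k) (basisAux n l k')
    rw [lie_Jthree_basisAux, lie_Jthree_basisAux, map_smulₛₗ, LinearMap.smul_apply, map_smul] at h1
    simp only [map_sub, Complex.conj_natCast, smul_eq_mul] at h1
    have h2 : ((k' : ℂ) - k) * B (basisAux n l k) (basisAux n l k') = 0 := by
      linear_combination h1
    refine (mul_eq_zero.1 h2).resolve_left fun h3 => h ⟨rfl, ?_⟩
    exact_mod_cast (sub_eq_zero.1 h3).symm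
  · have h1 := hB.casimir (basisAux n l k) (basisAux n l' k')
    rw [casimir_basisAux hk, casimir_basisAux hk', map_smulₛₗ, LinearMap.smul_apply, map_smul] at h1
    simp only [map_mul, map_add, map_one, Complex.conj_natCast, smul_eq_mul] at h1
    have h2 : ((l : ℂ) - l') * ((l : ℂ) + l' + 1) * B (basisAux n l k) (basisAux n l' k') = 0 := by
      linear_combination h1
    refine (mul_eq_zero.1 h2).resolve_left fun h3 => ?_
    rcases mul_eq_zero.1 h3 with h4 | h4
    · exact hl (by exact_mod_cast sub_eq_zero.1 h4)
    · have : ((l + l' + 1 : ℕ) : ℂ) = 0 := by exact_mod_cast h4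
      exact absurd (Nat.cast_eq_zero.1 this) (by omega)

theorem casimir_e {l : ℕ} {m : ℤ} (hm : m ∈ Finset.Icc (-(l : ℤ)) l) :
    casimir (e n l m) = ((l : ℂ) * (l + 1)) • e n l m :=
  casimir_basisAux (by rw [Finset.mem_Icc] at hm; omega)

theorem lie_Jthree_e {l : ℕ} {m : ℤ} (hm : m ∈ Finset.Icc (-(l : ℤ)) l) :
    ⁅Jthree n, e n l m⁆ = (m : ℂ) • e n l m := by
  rw [e, lie_Jthree_basisAux]
  congr 1
  rw [Finset.mem_Icc] at hm
  have h : (((l : ℤ) - m).toNat : ℤ) = l - m := Int.toNat_of_nonneg (by omega)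
  have h' : ((((l : ℤ) - m).toNat : ℤ) : ℂ) = l - m := by rw [h]; push_cast; ring
  rw [Int.cast_natCast] at h'
  rw [h']
  ring

theorem IsAdInvariant.e_e {B : Op n →ₗ⋆[ℂ] Op n →ₗ[ℂ] ℂ} (hB : IsAdInvariant B) {l l' : ℕ}
    {m m' : ℤ} (hm : m ∈ Finset.Icc (-(l : ℤ)) l) (hm' : m' ∈ Finset.Icc (-(l' : ℤ)) l') :
    B (e n l m) (e n l' m') = if l = l' ∧ m = m' then B (e n l 0) (e n l 0) else 0 := by
  rw [Finset.mem_Icc] at hm hm'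
  split_ifs with h
  · obtain ⟨rfl, rfl⟩ := h
    rw [e, hB.basisAux_same (by omega), e, hB.basisAux_same (k := ((l : ℤ) - 0).toNat) (by omega)]
  · refine hB.basisAux_eq_zero (by omega) (by omega) fun h' => h ⟨h'.1, ?_⟩
    obtain ⟨rfl, h2⟩ := h'
    omega

theorem zero_mem_Icc (l : ℕ) : (0 : ℤ) ∈ Finset.Icc (-(l : ℤ)) l := by
  rw [Finset.mem_Icc]
  omega

theorem hsInner_e {l l' : ℕ} (hl : l ≤ n)
    {m m' : ℤ} (hm : m ∈ Finset.Icc (-(l : ℤ)) l) (hm' : m' ∈ Finset.Icc (-(l' : ℤ)) l') :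
    hsInner (e n l m) (e n l' m') = if l = l' ∧ m = m' then 1 else 0 := by
  rw [← hsForm_apply, isAdInvariant_hsForm.e_e hm hm', hsForm_apply, e,
    ← hsForm_apply, isAdInvariant_hsForm.basisAux_same (by omega), hsForm_apply,
    hsInner_basisAux_zero hl]

/-- Indices of the coupled basis. -/
abbrev CoupledIndex (n : ℕ) : Type :=
  Σ l : Fin (n + 1), ↥(Finset.Icc (-((l : ℕ) : ℤ)) (l : ℕ))

theorem card_coupledIndex (n : ℕ) : Fintype.card (CoupledIndex n) = (n + 1) * (n + 1) := by
  rw [Fintype.card_sigma]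
  have h : ∀ l : Fin (n + 1), Fintype.card ↥(Finset.Icc (-((l : ℕ) : ℤ)) (l : ℕ)) = 2 * l + 1 := by
    intro l
    rw [Fintype.card_coe, Int.card_Icc]
    omega
  simp_rw [h]
  rw [Fin.sum_univ_eq_sum_range (fun l => 2 * l + 1) (n + 1)]
  induction n with
  | zero => rfl
  | succ n ih =>
    rw [Finset.sum_range_succ, ih fun l => by rw [Fintype.card_coe, Int.card_Icc]; omega]
    ring

/-- The e(l, m) are orthonormal, hence independent, and their number is the sum of the 2l + 1,
namely (n + 1)², the dimension of the operator space. -/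
theorem eq_sum_e (P : Op n) : P = ∑ l ∈ Finset.range (n + 1), ∑ m ∈ Finset.Icc (-(l : ℤ)) l,
    hsInner (e n l m) P • e n l m := by
  let v : CoupledIndex n → Op n := fun i => e n i.1 i.2
  have hv : ∀ i j, hsForm n (v i) (v j) = if i = j then 1 else 0 := by
    intro i j
    obtain ⟨l, m, hm⟩ := i
    obtain ⟨l', m', hm'⟩ := j
    rw [hsForm_apply, hsInner_e (by omega) hm hm']
    refine if_congr ⟨fun h => ?_, fun h => ?_⟩ rfl rfl
    · obtain ⟨h1, h2⟩ := h
      have h1 := Fin.ext h1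
      subst h1 h2
      rfl
    · cases h
      exact ⟨rfl, rfl⟩
  have hcoef : ∀ (g : CoupledIndex n → ℂ) (i : CoupledIndex n),
      hsForm n (v i) (∑ j, g j • v j) = g i := by
    intro g i
    rw [map_sum]
    simp [hv]
  have hli : LinearIndependent ℂ v := by
    rw [Fintype.linearIndependent_iff]
    intro g hg i
    rw [← hcoef g i, hg, map_zero]
  have hspan := hli.span_eq_top_of_card_eq_finrank' (by
    rw [card_coupledIndex, Module.finrank_matrix]
    simp)
  have hP : P ∈ Submodule.span ℂ (Set.range v) := by rw [hspan]; trivial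
  obtain ⟨g, hg⟩ := (Submodule.mem_span_range_iff_exists_fun ℂ).1 hP
  have hP' : P = ∑ i, hsInner (v i) P • v i := by
    conv_lhs => rw [← hg]
    refine Finset.sum_congr rfl fun i _ => ?_
    rw [← hsForm_apply, ← hg, hcoef]
  rw [Fintype.sum_sigma] at hP'
  rw [Finset.sum_range]
  conv_lhs => rw [hP']
  refine Finset.sum_congr rfl fun l _ => ?_
  exact Finset.sum_coe_sort (Finset.Icc (-((l : ℕ) : ℤ)) (l : ℕ))
    (fun m => hsInner (e n l m) P • e n l m)

theorem eq_sum_component (P : Op n) : P = ∑ l ∈ Finset.range (n + 1), component l P :=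
  eq_sum_e P

theorem IsAdInvariant.component_component {B : Op n →ₗ⋆[ℂ] Op n →ₗ[ℂ] ℂ} (hB : IsAdInvariant B)
    (l l' : ℕ) (P Q : Op n) : B (component l P) (component l' Q) =
      if l = l' then B (e n l 0) (e n l 0) *
        ∑ m ∈ Finset.Icc (-(l : ℤ)) l, conj (hsInner (e n l m) P) * hsInner (e n l m) Q else 0 := by
  simp only [component, map_sum, LinearMap.sum_apply, map_smulₛₗ, LinearMap.smul_apply,
    smul_eq_mul, RingHom.id_apply]
  split_ifs with h
  · subst h
    rw [Finset.mul_sum]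
    refine Finset.sum_congr rfl fun m hm => ?_
    rw [Finset.sum_eq_single m]
    · rw [hB.e_e hm hm, if_pos ⟨rfl, rfl⟩]
      ring
    · intro m' hm' hne
      rw [hB.e_e hm' hm, if_neg (fun h => hne h.2), mul_zero]
    · exact fun h => absurd hm h
  · refine Finset.sum_eq_zero fun m hm => mul_eq_zero_of_right _ ?_
    refine Finset.sum_eq_zero fun m' hm' => ?_
    rw [hB.e_e hm' hm, if_neg (fun h' => h h'.1), mul_zero]

theorem hsInner_component {l : ℕ} (hl : l ≤ n) (P Q : Op n) :
    hsInner (component l P) (component l Q) =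
      ∑ m ∈ Finset.Icc (-(l : ℤ)) l, conj (hsInner (e n l m) P) * hsInner (e n l m) Q := by
  rw [← hsForm_apply, isAdInvariant_hsForm.component_component, if_pos rfl, hsForm_apply,
    hsInner_e hl (zero_mem_Icc l) (zero_mem_Icc l), if_pos ⟨rfl, rfl⟩, one_mul]

/-- Schur's lemma for invariant sesquilinear forms. -/
theorem IsAdInvariant.eq_sum {B : Op n →ₗ⋆[ℂ] Op n →ₗ[ℂ] ℂ} (hB : IsAdInvariant B) (P Q : Op n) :
    B P Q = ∑ l ∈ Finset.range (n + 1),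
      B (e n l 0) (e n l 0) * hsInner (component l P) (component l Q) := by
  conv_lhs => rw [eq_sum_component P, eq_sum_component Q]
  simp only [map_sum, LinearMap.sum_apply]
  refine Finset.sum_congr rfl fun l hl => ?_
  rw [Finset.sum_eq_single l]
  · rw [hB.component_component, if_pos rfl,
      hsInner_component (by rw [Finset.mem_range] at hl; omega)]
  · intro l' _ hne
    rw [hB.component_component, if_neg hne]
  · exact fun h => absurd hl h

theorem hsInner_eq_sum_component (P Q : Op n) : hsInner P Q = ∑ l ∈ Finset.range (n + 1),
    hsInner (component l P) (component l Q) := by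
  rw [← hsForm_apply, isAdInvariant_hsForm.eq_sum]
  refine Finset.sum_congr rfl fun l hl => ?_
  rw [hsForm_apply, hsInner_e (by rw [Finset.mem_range] at hl; omega) (zero_mem_Icc l)
    (zero_mem_Icc l), if_pos ⟨rfl, rfl⟩, one_mul]

end Basis

/-! ### Parametrization of `SU(2)` and the covering map -/

theorem pauliDot_eq (v : Fin 3 → ℝ) : pauliDot v =
    !![(v 2 : ℂ), v 0 - v 1 * Complex.I; v 0 + v 1 * Complex.I, -v 2] := by
  ext i j
  fin_cases i <;> fin_cases j <;> simp [pauliDot]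
  ring

/-- The element of `SU(2)` with first column `(a, b)`. -/
def mkSU2 (a b : ℂ) (h : Complex.normSq a + Complex.normSq b = 1) : SU2 :=
  ⟨!![a, -conj b; b, conj a], by
    have h' : a * conj a + b * conj b = 1 := by
      rw [Complex.mul_conj, Complex.mul_conj]
      exact_mod_cast h
    rw [Matrix.mem_specialUnitaryGroup_iff, Matrix.mem_unitaryGroup_iff']
    constructor
    · ext i j
      fin_cases i <;> fin_cases j <;>
        simp [Matrix.mul_apply, Matrix.star_apply, Fin.sum_univ_two] <;>
        first | ring1 | linear_combination h'
    · rw [Matrix.det_fin_two_of]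
      linear_combination h'⟩

theorem coe_mkSU2 (a b : ℂ) (h : Complex.normSq a + Complex.normSq b = 1) :
    (mkSU2 a b h : Matrix (Fin 2) (Fin 2) ℂ) = !![a, -conj b; b, conj a] := rfl

theorem coe_inv_SU2 (U : SU2) : ((U⁻¹ : SU2) : Matrix (Fin 2) (Fin 2) ℂ)
    = star (U : Matrix (Fin 2) (Fin 2) ℂ) := rfl

theorem coe_inv_mkSU2 (a b : ℂ) (h : Complex.normSq a + Complex.normSq b = 1) :
    (((mkSU2 a b h)⁻¹ : SU2) : Matrix (Fin 2) (Fin 2) ℂ) = !![conj a, conj b; -b, a] := by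
  rw [coe_inv_SU2, coe_mkSU2]
  ext i j
  fin_cases i <;> fin_cases j <;> simp [Matrix.star_apply]

/-- The second column is orthogonal to the first, and the determinant fixes its phase. -/
theorem exists_eq_mkSU2 (U : SU2) : ∃ a b h, U = mkSU2 a b h := by
  obtain ⟨hU, hdet⟩ := Matrix.mem_specialUnitaryGroup_iff.1 U.2
  have h1 := Matrix.mem_unitaryGroup_iff'.1 hU
  set M := (U : Matrix (Fin 2) (Fin 2) ℂ) with hM
  rw [Matrix.det_fin_two] at hdet
  have e00 := congrFun (congrFun h1 0) 0
  have e01 := congrFun (congrFun h1 0) 1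
  simp only [Matrix.mul_apply, Fin.sum_univ_two, Matrix.star_apply, Matrix.one_apply_eq, ne_eq,
    zero_ne_one, not_false_eq_true, Matrix.one_apply_ne, Complex.star_def]
    at e00 e01
  have hn : Complex.normSq (M 0 0) + Complex.normSq (M 1 0) = 1 := by
    have : ((Complex.normSq (M 0 0) + Complex.normSq (M 1 0) : ℝ) : ℂ) = 1 := by
      push_cast
      rw [Complex.normSq_eq_conj_mul_self, Complex.normSq_eq_conj_mul_self]
      exact e00
    exact_mod_cast this
  refine ⟨M 0 0, M 1 0, hn, Subtype.ext ?_⟩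
  rw [coe_mkSU2, ← hM]
  ext i j
  fin_cases i <;> fin_cases j
  · rfl
  · simp
    linear_combination -conj (M 1 0) * hdet + M 0 0 * e01 - M 0 1 * e00
  · rfl
  · simp
    linear_combination conj (M 0 0) * hdet + M 1 0 * e01 - M 1 1 * e00

/-- The rotation matrix attached to a quaternion. -/
def quaternionRotation (p q r s : ℝ) : Matrix (Fin 3) (Fin 3) ℝ :=
  !![p ^ 2 - q ^ 2 - r ^ 2 + s ^ 2, 2 * p * q - 2 * r * s, 2 * (p * r + q * s);
    -2 * p * q - 2 * r * s, p ^ 2 - q ^ 2 + r ^ 2 - s ^ 2, 2 * (p * s - q * r);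
    -2 * (p * r - q * s), -2 * (p * s + q * r), p ^ 2 + q ^ 2 - r ^ 2 - s ^ 2]

theorem quaternionRotation_mem {p q r s : ℝ} (h : p ^ 2 + q ^ 2 + r ^ 2 + s ^ 2 = 1) :
    quaternionRotation p q r s ∈ Matrix.specialOrthogonalGroup (Fin 3) ℝ := by
  rw [Matrix.mem_specialOrthogonalGroup_iff, Matrix.mem_orthogonalGroup_iff']
  constructor
  · ext i j
    fin_cases i <;> fin_cases j <;>
      simp [quaternionRotation, Matrix.mul_apply, Fin.sum_univ_three] <;>
      first
        | ring1
        | linear_combination (p ^ 2 + q ^ 2 + r ^ 2 + s ^ 2 + 1) * h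
  · rw [Matrix.det_fin_three]
    simp [quaternionRotation]
    linear_combination ((p ^ 2 + q ^ 2 + r ^ 2 + s ^ 2) ^ 2 + p ^ 2 + q ^ 2 + r ^ 2 + s ^ 2 + 1) * h

theorem covers_mkSU2 (a b : ℂ) (h : Complex.normSq a + Complex.normSq b = 1)
    (h' : a.re ^ 2 + a.im ^ 2 + b.re ^ 2 + b.im ^ 2 = 1) :
    Covers (mkSU2 a b h)
      ⟨quaternionRotation a.re a.im b.re b.im, quaternionRotation_mem h'⟩ := by
  intro v
  rw [coe_mkSU2, coe_inv_mkSU2, pauliDot_eq, pauliDot_eq]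
  ext i j
  fin_cases i <;> fin_cases j <;> apply Complex.ext <;>
    simp [quaternionRotation, Matrix.mulVec, dotProduct, Fin.sum_univ_three, Matrix.mul_apply,
      Fin.sum_univ_two, pow_two] <;> ring

theorem normSq_add_normSq_eq_one_iff (a b : ℂ) : Complex.normSq a + Complex.normSq b = 1 ↔
    a.re ^ 2 + a.im ^ 2 + b.re ^ 2 + b.im ^ 2 = 1 := by
  rw [Complex.normSq_apply, Complex.normSq_apply]
  ring_nf

theorem exists_covers (U : SU2) : ∃ R : SO3, Covers U R := by
  obtain ⟨a, b, h, rfl⟩ := exists_eq_mkSU2 U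
  exact ⟨_, covers_mkSU2 a b h ((normSq_add_normSq_eq_one_iff a b).1 h)⟩

/-- A section of the Hopf map. The three expressions are the last column of `quaternionRotation p 0
r s`, the image of the north pole. -/
theorem exists_quaternion_column {x y z : ℝ} (h : x ^ 2 + y ^ 2 + z ^ 2 = 1) :
    ∃ p r s : ℝ, p ^ 2 + r ^ 2 + s ^ 2 = 1 ∧ 2 * (p * r) = x ∧ 2 * (p * s) = y ∧
      p ^ 2 - r ^ 2 - s ^ 2 = z := by
  -- The section divides by p = √((1 + z)/2), which vanishes exactly at the south pole.
  by_cases hz : z = -1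
  · subst hz
    have hx : x = 0 := by nlinarith [sq_nonneg x, sq_nonneg y]
    have hy : y = 0 := by nlinarith [sq_nonneg x, sq_nonneg y]
    exact ⟨0, 1, 0, by norm_num, by simp [hx], by simp [hy], by norm_num⟩
  · have hz1 : -1 ≤ z := by nlinarith [sq_nonneg x, sq_nonneg y]
    have hz2 : 0 < 1 + z := by
      rcases hz1.lt_or_eq with h1 | h1
      · linarith
      · exact absurd h1.symm hz
    set p := √((1 + z) / 2) with hp
    have hp0 : 0 < p := Real.sqrt_pos.2 (by linarith)
    have hp2 : p ^ 2 = (1 + z) / 2 := Real.sq_sqrt (by linarith)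
    have hrs : (x / (2 * p)) ^ 2 + (y / (2 * p)) ^ 2 = (1 - z) / 2 := by
      rw [div_pow, div_pow, mul_pow, hp2, ← add_div, div_eq_iff (by positivity)]
      linear_combination h
    refine ⟨p, x / (2 * p), y / (2 * p), by rw [add_assoc, hrs, hp2]; ring, by field_simp,
      by field_simp, by rw [sub_sub, hrs, hp2]; ring⟩

theorem S2.sum_sq (x : S2) : (x : EuclideanSpace ℝ (Fin 3)) 0 ^ 2
    + (x : EuclideanSpace ℝ (Fin 3)) 1 ^ 2 + (x : EuclideanSpace ℝ (Fin 3)) 2 ^ 2 = 1 := by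
  have hx : ‖(x : EuclideanSpace ℝ (Fin 3))‖ = 1 := by simp
  rw [EuclideanSpace.norm_eq, Real.sqrt_eq_one, Fin.sum_univ_three] at hx
  simpa using hx

theorem coe_rotate (R : SO3) (x : S2) : (rotate R x : EuclideanSpace ℝ (Fin 3)).ofLp
    = (R : Matrix (Fin 3) (Fin 3) ℝ) *ᵥ (x : EuclideanSpace ℝ (Fin 3)).ofLp := rfl

theorem coe_northPole : (northPole : EuclideanSpace ℝ (Fin 3)).ofLp = ![0, 0, 1] := rfl

/-- Transitivity of the rotations, together with a lift to SU(2), so that every value of a covariant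
map can be read off from a rotated kernel. -/
theorem exists_rotate_northPole (x : S2) :
    ∃ (U : SU2) (R : SO3), Covers U R ∧ rotate R northPole = x := by
  obtain ⟨p, r, s, h, h0, h1, h2⟩ := exists_quaternion_column (S2.sum_sq x)
  have hN : (p : ℂ).re ^ 2 + (p : ℂ).im ^ 2 + (⟨r, s⟩ : ℂ).re ^ 2 + (⟨r, s⟩ : ℂ).im ^ 2 = 1 := by
    simpa using h
  refine ⟨mkSU2 p ⟨r, s⟩ ((normSq_add_normSq_eq_one_iff _ _).2 hN), _, covers_mkSU2 _ _ _ hN, ?_⟩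
  apply Subtype.ext
  ext i
  rw [coe_rotate, coe_northPole]
  fin_cases i <;>
    simp [quaternionRotation, Matrix.mulVec, dotProduct, Fin.sum_univ_three, h0, h1, h2]

theorem rotation_mulVec_inv (R : SO3) (v : Fin 3 → ℝ) :
    (R : Matrix (Fin 3) (Fin 3) ℝ) *ᵥ (((R⁻¹ : SO3) : Matrix (Fin 3) (Fin 3) ℝ) *ᵥ v) = v := by
  rw [Matrix.mulVec_mulVec, ← Submonoid.coe_mul, mul_inv_cancel, Submonoid.coe_one,
    Matrix.one_mulVec]

theorem rotate_rotate_inv (R : SO3) (x : S2) : rotate R (rotate R⁻¹ x) = x := by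
  apply Subtype.ext
  ext i
  rw [coe_rotate, coe_rotate, rotation_mulVec_inv]

theorem Covers.inv {U : SU2} {R : SO3} (h : Covers U R) : Covers U⁻¹ R⁻¹ := by
  intro v
  have h1 := h (((R⁻¹ : SO3) : Matrix (Fin 3) (Fin 3) ℝ) *ᵥ v)
  rw [rotation_mulVec_inv] at h1
  rw [← h1, inv_inv]
  calc _ = ((U⁻¹ : SU2) : Matrix (Fin 2) (Fin 2) ℂ) * (U : Matrix (Fin 2) (Fin 2) ℂ) *
        pauliDot (((R⁻¹ : SO3) : Matrix (Fin 3) (Fin 3) ℝ) *ᵥ v) *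
        (((U⁻¹ : SU2) : Matrix (Fin 2) (Fin 2) ℂ) * (U : Matrix (Fin 2) (Fin 2) ℂ)) := by
        simp only [mul_assoc]
    _ = _ := by rw [← Submonoid.coe_mul, inv_mul_cancel, Submonoid.coe_one, one_mul, mul_one]

/-! ### From invariance under the group to invariance under the Lie algebra -/

section Invariance

variable {n : ℕ}

theorem normSq_exp_eq_one {v : Fin 3 → ℝ} (hv : v 0 ^ 2 + v 1 ^ 2 + v 2 ^ 2 = 1) (t : ℝ) :
    Complex.normSq (⟨Real.cos t, -Real.sin t * v 2⟩ : ℂ)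
      + Complex.normSq (⟨Real.sin t * v 1, -Real.sin t * v 0⟩ : ℂ) = 1 := by
  rw [Complex.normSq_mk, Complex.normSq_mk]
  linear_combination Real.sin t ^ 2 * hv + Real.sin_sq_add_cos_sq t

/-- The one-parameter subgroup `cos t - i sin t (v · σ)` of `SU(2)`. -/
def expSU2 (v : Fin 3 → ℝ) (hv : v 0 ^ 2 + v 1 ^ 2 + v 2 ^ 2 = 1) (t : ℝ) : SU2 :=
  mkSU2 ⟨Real.cos t, -Real.sin t * v 2⟩ ⟨Real.sin t * v 1, -Real.sin t * v 0⟩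
    (normSq_exp_eq_one hv t)

theorem coe_expSU2 (v : Fin 3 → ℝ) (hv : v 0 ^ 2 + v 1 ^ 2 + v 2 ^ 2 = 1) (t : ℝ) :
    (expSU2 v hv t : Matrix (Fin 2) (Fin 2) ℂ)
      = (Real.cos t : ℂ) • 1 + (Real.sin t : ℂ) • (-Complex.I • pauliDot v) := by
  rw [expSU2, coe_mkSU2, pauliDot_eq]
  ext i j
  fin_cases i <;> fin_cases j <;> apply Complex.ext <;>
    simp [-Complex.ofReal_cos, -Complex.ofReal_sin]

theorem coe_inv_expSU2 (v : Fin 3 → ℝ) (hv : v 0 ^ 2 + v 1 ^ 2 + v 2 ^ 2 = 1) (t : ℝ) :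
    (((expSU2 v hv t)⁻¹ : SU2) : Matrix (Fin 2) (Fin 2) ℂ)
      = (Real.cos t : ℂ) • 1 + (Real.sin t : ℂ) • (Complex.I • pauliDot v) := by
  rw [expSU2, coe_inv_mkSU2, pauliDot_eq]
  ext i j
  fin_cases i <;> fin_cases j <;> apply Complex.ext <;>
    simp [-Complex.ofReal_cos, -Complex.ofReal_sin]

theorem hasEntrywiseDeriv_cos_add_sin (X : Matrix (Fin 2) (Fin 2) ℂ) :
    HasEntrywiseDeriv (fun t : ℝ => (Real.cos t : ℂ) • (1 : Matrix (Fin 2) (Fin 2) ℂ)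
      + (Real.sin t : ℂ) • X) X := by
  intro a b
  have h1 := (Real.hasDerivAt_cos 0).ofReal_comp
  have h2 := (Real.hasDerivAt_sin 0).ofReal_comp
  have := (h1.mul_const ((1 : Matrix (Fin 2) (Fin 2) ℂ) a b)).fun_add (h2.mul_const (X a b))
  simpa using this

theorem spinDeriv_smul (c : ℂ) (X : Matrix (Fin 2) (Fin 2) ℂ) :
    spinDeriv n (c • X) = c • spinDeriv n X := by
  simp only [spinDeriv, Matrix.smul_apply, smul_eq_mul]
  module

/-- The factor 2 appears because v·J is half the derivative at v·σ: the parameter t is half the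
angle of rotation. -/
theorem hasEntrywiseDeriv_opAct_expSU2 (v : Fin 3 → ℝ) (hv : v 0 ^ 2 + v 1 ^ 2 + v 2 ^ 2 = 1)
    (P : Op n) : HasEntrywiseDeriv (fun t => opAct (expSU2 v hv t) P)
      ((-2 * Complex.I) • ⁅spinDot n v, P⁆) := by
  have h1 := spinRep_hasEntrywiseDeriv n (hasEntrywiseDeriv_cos_add_sin (-Complex.I • pauliDot v))
    (by simp)
  have h2 := spinRep_hasEntrywiseDeriv n (hasEntrywiseDeriv_cos_add_sin (Complex.I • pauliDot v))
    (by simp)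
  have h3 := (h1.mul (HasEntrywiseDeriv.const P)).mul h2
  simp only [opAct, coe_expSU2, coe_inv_expSU2]
  convert h3 using 1
  have hd : spinDeriv n (pauliDot v) = (2 : ℂ) • spinDot n v := by
    rw [spinDot_eq_spinDeriv, smul_smul]
    norm_num
  simp only [spinDeriv_smul, hd]
  simp [spinRep_one, Ring.lie_def, smul_smul]
  module

theorem sesq_eq_sum (B : Op n →ₗ⋆[ℂ] Op n →ₗ[ℂ] ℂ) (P Q : Op n) :
    B P Q = ∑ a, ∑ b, ∑ c, ∑ d, conj (P a b) * (Q c d *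
      B (Matrix.single a b 1) (Matrix.single c d 1)) := by
  have hs : ∀ P : Op n, P = ∑ a, ∑ b, P a b • Matrix.single a b (1 : ℂ) := by
    intro P
    conv_lhs => rw [Matrix.matrix_eq_sum_single P]
    simp [Matrix.smul_single]
  have hf : ∀ (f : Op n →ₗ[ℂ] ℂ) (Q : Op n),
      f Q = ∑ c, ∑ d, Q c d * f (Matrix.single c d 1) := by
    intro f Q
    conv_lhs => rw [hs Q]
    simp only [map_sum, map_smul, smul_eq_mul]
  conv_lhs => rw [hs P]
  simp only [map_sum, LinearMap.sum_apply, map_smulₛₗ, LinearMap.smul_apply, smul_eq_mul]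
  refine Finset.sum_congr rfl fun a _ => Finset.sum_congr rfl fun b _ => ?_
  rw [hf _ Q]
  simp only [Finset.mul_sum]

theorem hasDerivAt_sesq (B : Op n →ₗ⋆[ℂ] Op n →ₗ[ℂ] ℂ) {P Q : ℝ → Op n} {P' Q' : Op n}
    (hP : HasEntrywiseDeriv P P') (hQ : HasEntrywiseDeriv Q Q') :
    HasDerivAt (fun t => B (P t) (Q t)) (B P' (Q 0) + B (P 0) Q') 0 := by
  rw [sesq_eq_sum B P', sesq_eq_sum B _ Q']
  simp_rw [sesq_eq_sum B (P _)]
  simp only [← Finset.sum_add_distrib]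
  refine HasDerivAt.fun_sum fun a _ => HasDerivAt.fun_sum fun b _ => HasDerivAt.fun_sum fun c _ =>
    HasDerivAt.fun_sum fun d _ => ?_
  have h1 : HasDerivAt (fun t => conj (P t a b)) (conj (P' a b)) 0 := (hP a b).star
  exact h1.fun_mul ((hQ c d).mul_const _)

/-- Differentiate the constant t ↦ B(P^{U(t)}, Q^{U(t)}). Conjugate linearity turns -2i into 2i in
the first slot, so the two terms have opposite signs. -/
theorem sesq_lie_spinDot {B : Op n →ₗ⋆[ℂ] Op n →ₗ[ℂ] ℂ}
    (hB : ∀ (U : SU2) (P Q : Op n), B (opAct U P) (opAct U Q) = B P Q)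
    {v : Fin 3 → ℝ} (hv : v 0 ^ 2 + v 1 ^ 2 + v 2 ^ 2 = 1) (P Q : Op n) :
    B ⁅spinDot n v, P⁆ Q = B P ⁅spinDot n v, Q⁆ := by
  have h0 : expSU2 v hv 0 = 1 := by
    apply Subtype.ext
    rw [coe_expSU2]
    simp
  have h1 := hasDerivAt_sesq B (hasEntrywiseDeriv_opAct_expSU2 v hv P)
    (hasEntrywiseDeriv_opAct_expSU2 v hv Q)
  simp only [hB, h0, opAct_one] at h1
  have h2 := h1.unique (hasDerivAt_const 0 _)
  rw [map_smulₛₗ, map_smul, LinearMap.smul_apply, smul_eq_mul, smul_eq_mul] at h2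
  simp only [map_mul, map_neg, Complex.conj_I, Complex.conj_ofNat] at h2
  have h3 : (2 * Complex.I) * (B ⁅spinDot n v, P⁆ Q - B P ⁅spinDot n v, Q⁆) = 0 := by
    linear_combination h2
  exact sub_eq_zero.1 ((mul_eq_zero.1 h3).resolve_left (by simp))

theorem Jplus_eq_spinDot : Jplus n = spinDot n ![1, 0, 0] + Complex.I • spinDot n ![0, 1, 0] := by
  simp only [spinDot]
  simp [smul_smul, div_eq_mul_inv, ← mul_assoc]
  module

theorem Jminus_eq_spinDot : Jminus n = spinDot n ![1, 0, 0] - Complex.I • spinDot n ![0, 1, 0] := by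
  simp only [spinDot]
  simp [smul_smul, div_eq_mul_inv, ← mul_assoc]
  module

theorem Jthree_eq_spinDot : Jthree n = spinDot n ![0, 0, 1] := by
  simp [spinDot]

/-- Invariance under the group `SU(2)` implies invariance under the angular momentum operators. -/
theorem isAdInvariant_of_opAct {B : Op n →ₗ⋆[ℂ] Op n →ₗ[ℂ] ℂ}
    (hB : ∀ (U : SU2) (P Q : Op n), B (opAct U P) (opAct U Q) = B P Q) : IsAdInvariant B := by
  have h1 := sesq_lie_spinDot hB (v := ![1, 0, 0]) (by simp)
  have h2 := sesq_lie_spinDot hB (v := ![0, 1, 0]) (by simp)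
  have h3 := sesq_lie_spinDot hB (v := ![0, 0, 1]) (by simp)
  refine ⟨fun P Q => ?_, fun P Q => ?_, fun P Q => by rw [Jthree_eq_spinDot, h3]⟩
  -- J₊ and J₋ are J₁ ± iJ₂; conjugating i in the first slot exchanges them.
  · rw [Jplus_eq_spinDot, Jminus_eq_spinDot, sub_eq_add_neg, ← neg_smul]
    simp only [add_commutator, smul_commutator, map_add, LinearMap.add_apply, map_smulₛₗ,
      LinearMap.smul_apply, RingHom.id_apply, h1, h2, Complex.conj_I, smul_eq_mul]
  · rw [Jplus_eq_spinDot, Jminus_eq_spinDot, sub_eq_add_neg, ← neg_smul]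
    simp only [add_commutator, smul_commutator, map_add, LinearMap.add_apply, map_smulₛₗ,
      LinearMap.smul_apply, RingHom.id_apply, h1, h2, Complex.conj_I, smul_eq_mul, map_neg, neg_neg]

end Invariance

/-! ### Rotation invariance of the mean over the sphere -/

/-- A rotation as a linear isometry of Euclidean space. -/
def rotationIsometry (R : SO3) :
    EuclideanSpace ℝ (Fin 3) ≃ₗᵢ[ℝ] EuclideanSpace ℝ (Fin 3) :=
  LinearIsometry.toLinearIsometryEquiv
    { toFun := fun v => WithLp.toLp 2 ((R : Matrix (Fin 3) (Fin 3) ℝ) *ᵥ v.ofLp)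
      map_add' := fun v w => by simp [Matrix.mulVec_add]
      map_smul' := fun c v => by simp [Matrix.mulVec_smul]
      norm_map' := fun v => by
        rw [EuclideanSpace.norm_eq, EuclideanSpace.norm_eq]
        simpa using congrArg Real.sqrt (sum_sq_mulVec R v.ofLp) } rfl

theorem coe_rotate_eq (R : SO3) (x : S2) :
    (rotate R x : EuclideanSpace ℝ (Fin 3)) = rotationIsometry R x := rfl

theorem continuous_rotate (R : SO3) : Continuous (rotate R) :=
  ((rotationIsometry R).continuous.comp continuous_subtype_val).subtype_mk _

-- The surface measure of s is proportional to the volume of the cone (0, 1)·s, and a rotation maps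
-- cones to cones and preserves volume.
open scoped Pointwise in
theorem measurePreserving_rotate (R : SO3) : MeasurePreserving (rotate R)
    (volume : Measure (EuclideanSpace ℝ (Fin 3))).toSphere
    (volume : Measure (EuclideanSpace ℝ (Fin 3))).toSphere := by
  refine ⟨(continuous_rotate R).measurable, ?_⟩
  ext s hs
  have hpre : MeasurableSet (rotate R ⁻¹' s) := (continuous_rotate R).measurable hs
  rw [Measure.map_apply (continuous_rotate R).measurable hs, Measure.toSphere_apply' _ hpre,
    Measure.toSphere_apply' _ hs]
  congr 1
  have h := (rotationIsometry R).measurePreserving.measure_preimage_equiv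
    (f := (rotationIsometry R).toMeasurableEquiv)
    (Set.Ioo (0 : ℝ) 1 • ((↑) '' s : Set (EuclideanSpace ℝ (Fin 3))))
  rw [← h]
  congr 1
  ext v
  simp only [Set.mem_smul, Set.mem_image, Set.mem_preimage]
  constructor
  · rintro ⟨r, hr, _, ⟨y, hy, rfl⟩, rfl⟩
    exact ⟨r, hr, _, ⟨rotate R y, hy, rfl⟩, by
      simp [coe_rotate_eq]⟩
  · rintro ⟨r, hr, _, ⟨y, hy, rfl⟩, hv⟩
    refine ⟨r, hr, _, ⟨rotate R⁻¹ y, by rwa [rotate_rotate_inv], rfl⟩, ?_⟩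
    apply (rotationIsometry R).injective
    rw [map_smul, ← coe_rotate_eq, rotate_rotate_inv]
    exact hv

theorem sphereMean_rotate (R : SO3) {F : S2 → ℂ} (hF : Continuous F) :
    sphereMean (fun x => F (rotate R x)) = sphereMean F := by
  rw [sphereMean, sphereMean]
  congr 1
  have h := integral_map (μ := (volume : Measure (EuclideanSpace ℝ (Fin 3))).toSphere)
    (continuous_rotate R).measurable.aemeasurable (f := F) hF.aestronglyMeasurable
  rw [(measurePreserving_rotate R).map_eq] at h
  exact h.symm

theorem integrable_sphere {F : S2 → ℂ} (hF : Continuous F) :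
    Integrable F (volume : Measure (EuclideanSpace ℝ (Fin 3))).toSphere :=
  hF.integrable_of_hasCompactSupport (HasCompactSupport.of_compactSpace F)

theorem sphereMean_add {F G : S2 → ℂ} (hF : Continuous F) (hG : Continuous G) :
    sphereMean (fun x => F x + G x) = sphereMean F + sphereMean G := by
  rw [sphereMean, integral_add (integrable_sphere hF) (integrable_sphere hG), mul_add]
  rfl

theorem sphereMean_const_mul (c : ℂ) (F : S2 → ℂ) :
    sphereMean (fun x => c * F x) = c * sphereMean F := by
  rw [sphereMean, integral_const_mul, sphereMean]
  ring

theorem sphereMean_const (c : ℂ) : sphereMean (fun _ => c) = c := by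
  have h : (volume : Measure (EuclideanSpace ℝ (Fin 3))).toSphere.real Set.univ
      = 4 * Real.pi := by
    rw [Measure.toSphere_real_apply_univ, Measure.real, EuclideanSpace.volume_ball_fin_three]
    rw [ENNReal.toReal_mul, ENNReal.toReal_pow, ENNReal.toReal_ofReal zero_le_one,
      ENNReal.toReal_ofReal (by positivity)]
    simp
    ring
  rw [sphereMean, integral_const, h]
  have hpi : (Real.pi : ℂ) ≠ 0 := by exact_mod_cast Real.pi_ne_zero
  rw [Complex.real_smul]
  push_cast
  field_simp

/-! ### Functions of `J₃` -/

section Functional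

variable {n : ℕ}

theorem conjTranspose_spinDot (v : Fin 3 → ℝ) : (spinDot n v)ᴴ = spinDot n v := by
  simp only [spinDot, Matrix.conjTranspose_add, Matrix.conjTranspose_smul, conjTranspose_Jminus,
    conjTranspose_Jplus, conjTranspose_Jthree]
  simp
  module

theorem conjTranspose_aeval (p : Polynomial ℝ) {A : Op n} (hA : Aᴴ = A) :
    (Polynomial.aeval A p)ᴴ = Polynomial.aeval A p := by
  induction p using Polynomial.induction_on' with
  | add p q hp hq => rw [map_add, Matrix.conjTranspose_add, hp, hq]
  | monomial k c =>
    rw [Polynomial.aeval_monomial, Algebra.algebraMap_eq_smul_one, Matrix.smul_mul, one_mul,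
      Matrix.conjTranspose_smul, Matrix.conjTranspose_pow, hA]
    simp

theorem opAct_aeval (U : SU2) (p : Polynomial ℝ) (A : Op n) :
    opAct U (Polynomial.aeval A p) = Polynomial.aeval (opAct U A) p :=
  (Polynomial.aeval_algHom_apply ((opActHom U).restrictScalars ℝ) A p).symm

theorem aeval_diagonal (p : Polynomial ℝ) (d : Fin (n + 1) → ℝ) :
    Polynomial.aeval (Matrix.diagonal fun a => (d a : ℂ) : Op n) p
      = Matrix.diagonal fun a => ((p.eval (d a) : ℝ) : ℂ) := by
  have h := Polynomial.aeval_algHom_apply (Matrix.diagonalAlgHom (n := Fin (n + 1)) (α := ℂ) ℝ)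
    (fun a => (d a : ℂ)) p
  have h2 : ∀ f : Fin (n + 1) → ℂ, Matrix.diagonalAlgHom (n := Fin (n + 1)) (α := ℂ) ℝ f
    = Matrix.diagonal f := fun _ => rfl
  rw [h2, h2] at h
  rw [h]
  congr 1
  ext a
  have h3 := Polynomial.aeval_algHom_apply (Pi.evalAlgHom ℝ (fun _ : Fin (n + 1) => ℂ) a)
    (fun a => (d a : ℂ)) p
  simp only [Pi.evalAlgHom_apply] at h3
  rw [← h3]
  exact Polynomial.aeval_algebraMap_apply_eq_algebraMap_eval (A := ℂ) (d a) p

/-- Every real diagonal matrix is a real polynomial in `J₃`. -/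
theorem exists_aeval_Jthree (d : Fin (n + 1) → ℝ) :
    ∃ p : Polynomial ℝ, Polynomial.aeval (Jthree n) p = Matrix.diagonal fun a => (d a : ℂ) := by
  let v : Fin (n + 1) → ℝ := fun a => (n : ℝ) / 2 - (a : ℕ)
  -- The spectrum of J₃ is simple, so interpolation at its eigenvalues reaches every diagonal
  -- matrix.
  have hv : Set.InjOn v (Finset.univ : Finset (Fin (n + 1))) := by
    intro a _ b _ hab
    simp only [v, sub_right_inj, Nat.cast_inj] at hab
    exact Fin.ext hab
  refine ⟨Lagrange.interpolate Finset.univ v d, ?_⟩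
  rw [Jthree, aeval_diagonal]
  congr 1
  ext a
  rw [Lagrange.eval_interpolate_at_node d hv (Finset.mem_univ a)]

/-- The (a, b) entry of [J₃, A] is (b - a) times that of A, so commuting with J₃ means being
diagonal. -/
theorem exists_aeval_of_commute {A : Op n} (h : ⁅Jthree n, A⁆ = 0) (hreal : ∀ a, (A a a).im = 0) :
    ∃ p : Polynomial ℝ, Polynomial.aeval (Jthree n) p = A := by
  obtain ⟨p, hp⟩ := exists_aeval_Jthree fun a => (A a a).re
  refine ⟨p, hp.trans ?_⟩
  ext a b
  rw [Matrix.diagonal_apply]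
  split_ifs with hab
  · subst hab
    exact Complex.ext rfl (by simp [hreal])
  · have h1 := congrFun (congrFun h a) b
    rw [lie_Jthree_apply] at h1
    refine ((mul_eq_zero.1 h1).resolve_left fun h2 => hab (Fin.ext ?_)).symm
    exact_mod_cast (sub_eq_zero.1 h2).symm

theorem conj_basisAux_apply (l k : ℕ) (a b : Fin (n + 1)) :
    conj (basisAux n l k a b) = basisAux n l k a b := by
  have hm : ∀ a b : Fin (n + 1), conj (Jminus n a b) = Jminus n a b := by
    intro a b
    rw [Jminus_apply]
    split_ifs <;> simp
  have hp : ∀ a b : Fin (n + 1), conj (Jplus n a b) = Jplus n a b := fun a b => hm b a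
  have hpow : ∀ (l : ℕ) (a b : Fin (n + 1)), conj ((Jplus n ^ l) a b) = (Jplus n ^ l) a b := by
    intro l
    induction l with
    | zero =>
      intro a b
      rw [pow_zero, Matrix.one_apply]
      split_ifs <;> simp
    | succ l ih =>
      intro a b
      rw [pow_succ, Matrix.mul_apply, map_sum]
      simp only [map_mul, ih, hp]
  induction k generalizing a b with
  | zero =>
    rw [basisAux, Matrix.smul_apply, smul_eq_mul, map_mul, hpow, Complex.conj_ofReal]
  | succ k ih =>
    rw [basisAux, Matrix.smul_apply, smul_eq_mul, map_mul, Complex.conj_ofReal, Matrix.sub_apply,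
      map_sub, Matrix.mul_apply, Matrix.mul_apply, map_sum, map_sum]
    simp only [map_mul, ih, hm]

theorem lie_Jthree_e_zero (l : ℕ) : ⁅Jthree n, e n l 0⁆ = 0 := by
  rw [lie_Jthree_e (zero_mem_Icc l)]
  simp

theorem exists_aeval_e_zero (n l : ℕ) :
    ∃ p : Polynomial ℝ, Polynomial.aeval (Jthree n) p = e n l 0 :=
  exists_aeval_of_commute (lie_Jthree_e_zero l)
    fun a => Complex.conj_eq_iff_im.1 (conj_basisAux_apply l _ a a)

/-- Rotating p(J₃) gives p(v·J), where v is the image of the third axis, and v·J is Hermitian. This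
takes the place of unitarity of the representation. -/
theorem conjTranspose_opAct_aeval (U : SU2) (p : Polynomial ℝ) :
    (opAct U (Polynomial.aeval (Jthree n) p))ᴴ = opAct U (Polynomial.aeval (Jthree n) p) := by
  obtain ⟨R, hR⟩ := exists_covers U
  rw [opAct_aeval, Jthree_eq_spinDot, opAct_spinDot n hR]
  exact conjTranspose_aeval p (conjTranspose_spinDot _)

theorem conjTranspose_opAct_e_zero (U : SU2) (l : ℕ) :
    (opAct U (e n l 0))ᴴ = opAct U (e n l 0) := by
  obtain ⟨p, hp⟩ := exists_aeval_e_zero n l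
  rw [← hp, conjTranspose_opAct_aeval]

theorem conjTranspose_e_zero (l : ℕ) : (e n l 0)ᴴ = e n l 0 := by
  simpa only [opAct_one] using conjTranspose_opAct_e_zero (n := n) 1 l

end Functional

/-! ### The Casimir operator commutes with the group -/

section Casimir

variable {n : ℕ}

/-- The commutator as a bilinear map. -/
def commutatorMap (n : ℕ) : Op n →ₗ[ℂ] Op n →ₗ[ℂ] Op n :=
  LinearMap.mk₂ ℂ (fun A P => ⁅A, P⁆) (fun A A' P => add_commutator A A' P)
    (fun c A P => smul_commutator A P c) (fun A P Q => commutator_add A P Q)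
    (fun c A P => commutator_smul A P c)

theorem commutatorMap_apply (A P : Op n) : commutatorMap n A P = ⁅A, P⁆ := rfl

/-- The Cartesian components of the angular momentum. -/
def spinComponent (n : ℕ) (i : Fin 3) : Op n := spinDot n (Pi.single i 1)

theorem spinDot_eq_sum (v : Fin 3 → ℝ) : spinDot n v = ∑ i, (v i : ℂ) • spinComponent n i := by
  simp [Fin.sum_univ_three, spinComponent, spinDot, Pi.single_apply]
  module

/-- The Cartesian form J₁² + J₂² + J₃² displays rotation invariance; it comes from J₋J₊ + J₃ = (J₊J₋
+ J₋J₊)/2. -/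
theorem casimir_eq_sum (P : Op n) :
    casimir P = ∑ i, ⁅spinComponent n i, ⁅spinComponent n i, P⁆⁆ := by
  have h1 : Jplus n = spinComponent n 0 + Complex.I • spinComponent n 1 := by
    rw [Jplus_eq_spinDot]
    simp [spinDot_eq_sum, Fin.sum_univ_three]
  have h2 : Jminus n = spinComponent n 0 + (-Complex.I) • spinComponent n 1 := by
    rw [Jminus_eq_spinDot]
    simp [spinDot_eq_sum, Fin.sum_univ_three, sub_eq_add_neg]
  have h3 : Jthree n = spinComponent n 2 := by
    rw [Jthree_eq_spinDot]
    simp [spinDot_eq_sum, Fin.sum_univ_three]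
  have h4 : casimir P = (1 / 2 : ℂ) • (⁅Jplus n, ⁅Jminus n, P⁆⁆ + ⁅Jminus n, ⁅Jplus n, P⁆⁆)
      + ⁅Jthree n, ⁅Jthree n, P⁆⁆ := by
    rw [commutator_jacobi (Jplus n), lie_Jplus_Jminus, smul_commutator, casimir]
    module
  rw [h4, Fin.sum_univ_three, ← h3, h1, h2]
  simp only [add_commutator, smul_commutator, commutator_add, commutator_smul, smul_add, smul_smul,
    neg_mul, mul_neg, Complex.I_mul_I]
  module

theorem opAct_commutator (U : SU2) (A P : Op n) : opAct U ⁅A, P⁆ = ⁅opAct U A, opAct U P⁆ := by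
  simp only [Ring.lie_def, ← opActHom_apply, map_sub, map_mul]

/-- The components of J are mixed by R, and R Rᵀ = 1 restores the sum of squares. -/
theorem casimir_opAct (U : SU2) (P : Op n) : casimir (opAct U P) = opAct U (casimir P) := by
  obtain ⟨R, hR⟩ := exists_covers U
  have hRR : ∀ j k, ∑ i, ((R : Matrix (Fin 3) (Fin 3) ℝ) j i : ℂ)
      * ((R : Matrix (Fin 3) (Fin 3) ℝ) k i : ℂ) = if j = k then 1 else 0 := by
    intro j k
    have h := (Matrix.mem_orthogonalGroup_iff (Fin 3) ℝ).1
      (Matrix.mem_specialOrthogonalGroup_iff.1 R.2).1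
    have h1 := congrFun (congrFun h j) k
    rw [Matrix.mul_apply, Matrix.one_apply] at h1
    have h2 : ∑ i, (R : Matrix (Fin 3) (Fin 3) ℝ) j i * (R : Matrix (Fin 3) (Fin 3) ℝ) k i
      = if j = k then 1 else 0 := h1
    have h3 := congrArg (fun r : ℝ => (r : ℂ)) h2
    simp only [Complex.ofReal_sum, Complex.ofReal_mul] at h3
    rw [h3]
    split_ifs <;> simp
  have hJ : ∀ i, opAct U (spinComponent n i)
      = ∑ j, ((R : Matrix (Fin 3) (Fin 3) ℝ) j i : ℂ) • spinComponent n j := by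
    intro i
    rw [spinComponent, opAct_spinDot n hR, spinDot_eq_sum]
    simp
  rw [casimir_eq_sum, casimir_eq_sum, ← opActHom_apply U (∑ i, _), map_sum]
  simp only [opActHom_apply, opAct_commutator, hJ]
  simp only [← commutatorMap_apply]
  simp only [map_sum, map_smul, LinearMap.sum_apply, LinearMap.smul_apply, Finset.smul_sum,
    smul_smul]
  rw [Finset.sum_comm]
  refine Finset.sum_congr rfl fun j _ => ?_
  rw [Finset.sum_comm]
  simp only [← Finset.sum_smul, hRR]
  simp

/-- Rotation keeps the Casimir eigenvalue l(l + 1), and eigenspaces of the symmetric Casimir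
operator are orthogonal. -/
theorem hsInner_opAct_e_zero (U : SU2) {l l' : ℕ} {m : ℤ} (hm : m ∈ Finset.Icc (-(l' : ℤ)) l')
    (h : l' ≠ l) : hsInner (e n l' m) (opAct U (e n l 0)) = 0 := by
  have h1 := isAdInvariant_hsForm.casimir (e n l' m) (opAct U (e n l 0))
  rw [casimir_opAct, casimir_e hm, casimir_e (zero_mem_Icc l), ← opActHom_apply U (_ • _),
    map_smul (opActHom U), opActHom_apply, LinearMap.map_smul (hsForm n (e n l' m)), map_smulₛₗ,
    LinearMap.smul_apply, hsForm_apply] at h1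
  simp only [map_mul, map_add, map_one, Complex.conj_natCast, smul_eq_mul] at h1
  have h2 : ((l' : ℂ) - l) * ((l' : ℂ) + l + 1) * hsInner (e n l' m) (opAct U (e n l 0)) = 0 := by
    linear_combination h1
  refine (mul_eq_zero.1 h2).resolve_left fun h3 => ?_
  rcases mul_eq_zero.1 h3 with h4 | h4
  · exact h (by exact_mod_cast sub_eq_zero.1 h4)
  · have : ((l' + l + 1 : ℕ) : ℂ) = 0 := by exact_mod_cast h4
    exact absurd (Nat.cast_eq_zero.1 this) (by omega)

theorem component_opAct_e_zero (U : SU2) {l : ℕ} (hl : l ∈ Finset.range (n + 1)) :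
    component l (opAct U (e n l 0)) = opAct U (e n l 0) := by
  conv_rhs => rw [eq_sum_component (opAct U (e n l 0))]
  rw [Finset.sum_eq_single l]
  · intro l' _ hne
    refine Finset.sum_eq_zero fun m hm => ?_
    rw [hsInner_opAct_e_zero U hm hne, zero_smul]
  · exact fun h => absurd hl h

/-- The operator `∑ γ_l e(l, 0)`. -/
def zonalKernel (n : ℕ) (γ : ℕ → ℝ) : Op n :=
  ∑ l ∈ Finset.range (n + 1), (γ l : ℂ) • e n l 0

theorem opAct_zonalKernel (U : SU2) (γ : ℕ → ℝ) : opAct U (zonalKernel n γ)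
    = ∑ l ∈ Finset.range (n + 1), (γ l : ℂ) • opAct U (e n l 0) := by
  simp only [zonalKernel, ← opActHom_apply, map_sum, map_smul]

theorem conjTranspose_opAct_zonalKernel (U : SU2) (γ : ℕ → ℝ) :
    (opAct U (zonalKernel n γ))ᴴ = opAct U (zonalKernel n γ) := by
  simp only [opAct_zonalKernel, Matrix.conjTranspose_sum, Matrix.conjTranspose_smul,
    conjTranspose_opAct_e_zero]
  simp

theorem hsInner_e_opAct_zonalKernel (U : SU2) (γ : ℕ → ℝ) {l : ℕ} {m : ℤ}
    (hl : l ∈ Finset.range (n + 1)) (hm : m ∈ Finset.Icc (-(l : ℤ)) l) :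
    hsInner (e n l m) (opAct U (zonalKernel n γ))
      = γ l * hsInner (e n l m) (opAct U (e n l 0)) := by
  rw [opAct_zonalKernel, ← hsForm_apply, map_sum, Finset.sum_eq_single l]
  · rw [map_smul, smul_eq_mul, hsForm_apply]
  · intro l' _ hne
    rw [map_smul, hsForm_apply, hsInner_opAct_e_zero U hm hne.symm, smul_zero]
  · exact fun h => absurd hl h

/-- For a Hermitian operator the squared norm is the trace of the square, and the action is
multiplicative and preserves the trace. -/
theorem hsInner_opAct_e_zero_self (U : SU2) {l : ℕ} (hl : l ≤ n) :
    hsInner (opAct U (e n l 0)) (opAct U (e n l 0)) = 1 := by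
  rw [hsInner, conjTranspose_opAct_e_zero, ← opActHom_apply, ← map_mul, opActHom_apply,
    trace_opAct]
  have h := hsInner_e hl (zero_mem_Icc l) (zero_mem_Icc l)
  rw [if_pos ⟨rfl, rfl⟩, hsInner, conjTranspose_e_zero] at h
  exact h

/-- An addition theorem: by Parseval in degree l the sum is the squared norm of γ_l times a rotated
e(l, 0), a unit vector, and so does not depend on U. -/
theorem sum_normSq_trace_e_mul_opAct_zonalKernel (U : SU2) (γ : ℕ → ℝ) {l : ℕ}
    (hl : l ∈ Finset.range (n + 1)) :
    ∑ m ∈ Finset.Icc (-(l : ℤ)) l, conj ((e n l m * opAct U (zonalKernel n γ)).trace)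
      * (e n l m * opAct U (zonalKernel n γ)).trace = ((γ l ^ 2 : ℝ) : ℂ) := by
  have hln : l ≤ n := by rw [Finset.mem_range] at hl; omega
  have h1 : ∀ m ∈ Finset.Icc (-(l : ℤ)) l, conj ((e n l m * opAct U (zonalKernel n γ)).trace)
      * (e n l m * opAct U (zonalKernel n γ)).trace
      = ((γ l ^ 2 : ℝ) : ℂ) * (conj (hsInner (e n l m) (opAct U (e n l 0)))
        * hsInner (e n l m) (opAct U (e n l 0))) := by
    intro m hm
    have h2 : (e n l m * opAct U (zonalKernel n γ)).trace
        = conj (hsInner (e n l m) (opAct U (zonalKernel n γ))) := by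
      rw [hsInner_conj, hsInner, conjTranspose_opAct_zonalKernel, Matrix.trace_mul_comm]
    rw [h2, hsInner_e_opAct_zonalKernel U γ hl hm, Complex.conj_conj, map_mul,
      Complex.conj_ofReal]
    push_cast
    ring
  rw [Finset.sum_congr rfl h1, ← Finset.mul_sum, ← hsInner_component hln,
    component_opAct_e_zero U hl, hsInner_opAct_e_zero_self U hln, mul_one]

end Casimir

/-! ### Covariant maps from operators to functions on the sphere -/

section Covariant

variable {n : ℕ}

/-- Continuous and rotation equivariant linear maps from operators to functions. -/
structure IsCovariant (W : Op n →ₗ[ℂ] (S2 → ℂ)) : Prop where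
  continuous : ∀ P, Continuous (W P)
  equivariant : ∀ (R : SO3) (U : SU2), Covers U R → ∀ (P : Op n) (x : S2),
    W (opAct U P) x = W P (rotate R⁻¹ x)

/-- The matrix `K` with `W_P(n₀) = trace (P K)`. -/
def kernelOf (W : Op n →ₗ[ℂ] (S2 → ℂ)) : Op n := fun a b => W (Matrix.single b a 1) northPole

theorem apply_northPole (W : Op n →ₗ[ℂ] (S2 → ℂ)) (P : Op n) :
    W P northPole = (P * kernelOf W).trace := by
  conv_lhs => rw [Matrix.matrix_eq_sum_single P]
  have hs : ∀ a b, Matrix.single a b (P a b) = P a b • Matrix.single a b (1 : ℂ) := by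
    intro a b
    simp [Matrix.smul_single]
  simp only [hs, map_sum, map_smul, Finset.sum_apply, Pi.smul_apply, smul_eq_mul, Matrix.trace,
    Matrix.diag_apply, Matrix.mul_apply, kernelOf]

namespace IsCovariant

variable {W : Op n →ₗ[ℂ] (S2 → ℂ)}

theorem apply_rotate (hW : IsCovariant W) {R : SO3} {U : SU2} (h : Covers U R) (P : Op n) :
    W P (rotate R northPole) = (P * opAct U (kernelOf W)).trace := by
  -- Equivariance evaluates at R⁻¹x, so it is applied to the inverse rotation; moving it across the
  -- trace puts U on the kernel.
  have h1 := hW.equivariant R⁻¹ U⁻¹ h.inv P northPole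
  rw [inv_inv] at h1
  rw [← h1, apply_northPole, trace_opAct_mul, inv_inv]

/-- The pullback of the `L²` inner product of functions on the sphere. -/
def form (hW : IsCovariant W) : Op n →ₗ⋆[ℂ] Op n →ₗ[ℂ] ℂ :=
  LinearMap.mk₂'ₛₗ (starRingEnd ℂ) (RingHom.id ℂ) (fun P Q => sphereInner (W P) (W Q))
    (fun P P' Q => by
      simp only [sphereInner, map_add, Pi.add_apply, add_mul]
      exact sphereMean_add ((continuous_star.comp (hW.continuous P)).mul (hW.continuous Q))
        ((continuous_star.comp (hW.continuous P')).mul (hW.continuous Q)))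
    (fun c P Q => by
      simp only [sphereInner, map_smul, Pi.smul_apply, smul_eq_mul, map_mul, mul_assoc]
      exact sphereMean_const_mul _ _)
    (fun P Q Q' => by
      simp only [sphereInner, map_add, Pi.add_apply, mul_add]
      exact sphereMean_add ((continuous_star.comp (hW.continuous P)).mul (hW.continuous Q))
        ((continuous_star.comp (hW.continuous P)).mul (hW.continuous Q')))
    (fun c P Q => by
      simp only [sphereInner, map_smul, Pi.smul_apply, smul_eq_mul, RingHom.id_apply]
      rw [← sphereMean_const_mul]
      congr 1
      ext x
      ring)

theorem form_apply (hW : IsCovariant W) (P Q : Op n) :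
    hW.form P Q = sphereInner (W P) (W Q) := rfl

theorem isAdInvariant_form (hW : IsCovariant W) : IsAdInvariant hW.form := by
  refine isAdInvariant_of_opAct fun U P Q => ?_
  obtain ⟨R, hR⟩ := exists_covers U
  rw [form_apply, form_apply, sphereInner]
  simp only [hW.equivariant R U hR]
  exact sphereMean_rotate R⁻¹ (F := fun x => conj (W P x) * W Q x)
    ((continuous_star.comp (hW.continuous P)).mul (hW.continuous Q))

/-- The metric identity. -/
theorem sphereInner_eq (hW : IsCovariant W) {γ : ℕ → ℝ} (hK : kernelOf W = zonalKernel n γ)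
    (P Q : Op n) : sphereInner (W P) (W Q) = ∑ l ∈ Finset.range (n + 1),
      ((γ l ^ 2 / (2 * (l : ℝ) + 1) : ℝ) : ℂ) * hsInner (component l P) (component l Q) := by
  rw [← hW.form_apply, hW.isAdInvariant_form.eq_sum]
  refine Finset.sum_congr rfl fun l hl => ?_
  congr 1
  -- The Schur constant is found by summing over the 2l + 1 equal diagonal values: only for the sum
  -- is the integrand a constant function.
  have h1 : ∑ m ∈ Finset.Icc (-(l : ℤ)) l, hW.form (e n l m) (e n l m)
      = (2 * (l : ℂ) + 1) * hW.form (e n l 0) (e n l 0) := by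
    have h2 : ∀ m ∈ Finset.Icc (-(l : ℤ)) l, hW.form (e n l m) (e n l m)
        = hW.form (e n l 0) (e n l 0) := by
      intro m hm
      rw [hW.isAdInvariant_form.e_e hm hm, if_pos ⟨rfl, rfl⟩]
    have h3 : ((l : ℤ) + 1 - -(l : ℤ)).toNat = 2 * l + 1 := by omega
    rw [Finset.sum_congr rfl h2, Finset.sum_const, Int.card_Icc, h3, nsmul_eq_mul]
    push_cast
    ring
  have h2 : ∑ m ∈ Finset.Icc (-(l : ℤ)) l, hW.form (e n l m) (e n l m) = ((γ l ^ 2 : ℝ) : ℂ) := by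
    simp only [form_apply, sphereInner, sphereMean]
    rw [← Finset.mul_sum, ← integral_finsetSum _ fun m _ => integrable_sphere
      (F := fun x => conj (W (e n l m) x) * W (e n l m) x)
      ((continuous_star.comp (hW.continuous (e n l m))).mul (hW.continuous (e n l m)))]
    have h3 : ∀ x, ∑ m ∈ Finset.Icc (-(l : ℤ)) l, conj (W (e n l m) x) * W (e n l m) x
        = ((γ l ^ 2 : ℝ) : ℂ) := by
      intro x
      obtain ⟨U, R, hU, rfl⟩ := exists_rotate_northPole x
      simp only [hW.apply_rotate hU, hK]
      exact sum_normSq_trace_e_mul_opAct_zonalKernel U γ hl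
    simp only [h3]
    exact sphereMean_const _
  have h3 : (2 * (l : ℂ) + 1) ≠ 0 := by
    have : ((2 * l + 1 : ℕ) : ℂ) ≠ 0 := Nat.cast_ne_zero.2 (by omega)
    exact_mod_cast this
  rw [h1] at h2
  rw [Complex.ofReal_div, ← h2]
  push_cast
  field_simp

end IsCovariant

end Covariant

/-! ### The operator kernel -/

section Kernel

variable {n : ℕ}

theorem e_zero_zero : e n 0 0 = (((1 / √((n : ℝ) + 1) : ℝ)) : ℂ) • (1 : Op n) := by
  have h : e n 0 0 = basisAux n 0 0 := rfl
  rw [h, basisAux, mu]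
  simp

theorem one_eq_smul_e : (1 : Op n) = ((√((n : ℝ) + 1) : ℝ) : ℂ) • e n 0 0 := by
  have h : √((n : ℝ) + 1) ≠ 0 := (Real.sqrt_pos.2 (by positivity)).ne'
  rw [e_zero_zero, smul_smul, ← Complex.ofReal_mul, mul_one_div_cancel h, Complex.ofReal_one,
    one_smul]

theorem hsInner_smul_left (c : ℂ) (P Q : Op n) : hsInner (c • P) Q = conj c * hsInner P Q := by
  rw [← hsForm_apply, map_smulₛₗ]
  rfl

theorem hsInner_one (P : Op n) : hsInner 1 P = P.trace := by
  simp [hsInner]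

theorem hsInner_e_zero_zero (P : Op n) :
    hsInner (e n 0 0) P = ((1 / √((n : ℝ) + 1) : ℝ) : ℂ) * P.trace := by
  rw [e_zero_zero, hsInner_smul_left, Complex.conj_ofReal, hsInner_one]

theorem hsInner_component_e {l l' : ℕ} {m : ℤ} (hl : l ≤ n) (hm : m ∈ Finset.Icc (-(l' : ℤ)) l')
    (P : Op n) : hsInner (component l (e n l' m)) (component l P)
      = if l = l' then hsInner (e n l' m) P else 0 := by
  rw [hsInner_component hl]
  split_ifs with h
  · subst h
    rw [Finset.sum_eq_single m]
    · rw [hsInner_e hl hm hm, if_pos ⟨rfl, rfl⟩, map_one, one_mul]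
    · intro m' hm' hne
      rw [hsInner_e hl hm' hm, if_neg (fun h => hne h.2), map_zero, zero_mul]
    · exact fun h => absurd hm h
  · refine Finset.sum_eq_zero fun m' hm' => ?_
    rw [hsInner_e hl hm' hm, if_neg (fun h' => h h'.1), map_zero, zero_mul]

theorem hsInner_e_zonalKernel (γ : ℕ → ℝ) {l : ℕ} (hl : l ∈ Finset.range (n + 1)) :
    hsInner (e n l 0) (zonalKernel n γ) = γ l := by
  have h := hsInner_e_opAct_zonalKernel (n := n) 1 γ hl (zero_mem_Icc l)
  rw [opAct_one, opAct_one, hsInner_e (by rw [Finset.mem_range] at hl; omega) (zero_mem_Icc l)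
    (zero_mem_Icc l), if_pos ⟨rfl, rfl⟩, mul_one] at h
  exact h

theorem trace_zonalKernel (γ : ℕ → ℝ) :
    (zonalKernel n γ).trace = ((√((n : ℝ) + 1) * γ 0 : ℝ) : ℂ) := by
  have h := hsInner_e_zonalKernel (n := n) γ (l := 0) (by simp)
  rw [hsInner_e_zero_zero] at h
  have h0 : √((n : ℝ) + 1) ≠ 0 := (Real.sqrt_pos.2 (by positivity)).ne'
  have h0' : ((√((n : ℝ) + 1) : ℝ) : ℂ) ≠ 0 := by exact_mod_cast h0
  rw [Complex.ofReal_mul, ← h]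
  push_cast
  field_simp

namespace IsCovariant

variable {W : Op n →ₗ[ℂ] (S2 → ℂ)}

theorem sphereInner_e (hW : IsCovariant W) {γ : ℕ → ℝ} (hK : kernelOf W = zonalKernel n γ)
    {l : ℕ} {m : ℤ} (hl : l ∈ Finset.range (n + 1)) (hm : m ∈ Finset.Icc (-(l : ℤ)) l)
    (P : Op n) : sphereInner (W (e n l m)) (W P)
      = ((γ l ^ 2 / (2 * (l : ℝ) + 1) : ℝ) : ℂ) * hsInner (e n l m) P := by
  rw [hW.sphereInner_eq hK, Finset.sum_eq_single l]
  · rw [hsInner_component_e (by rw [Finset.mem_range] at hl; omega) hm, if_pos rfl]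
  · intro l' hl' hne
    rw [hsInner_component_e (by rw [Finset.mem_range] at hl'; omega) hm, if_neg hne, mul_zero]
  · exact fun h => absurd hl h

theorem apply_one (hW : IsCovariant W) (x : S2) : W 1 x = (kernelOf W).trace := by
  obtain ⟨U, R, hU, rfl⟩ := exists_rotate_northPole x
  rw [hW.apply_rotate hU, one_mul, trace_opAct]

theorem ext_kernelOf (hW : IsCovariant W) {W' : Op n →ₗ[ℂ] (S2 → ℂ)} (hW' : IsCovariant W')
    (h : kernelOf W = kernelOf W') : W = W' := by
  refine LinearMap.ext fun P => funext fun x => ?_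
  obtain ⟨U, R, hU, rfl⟩ := exists_rotate_northPole x
  rw [hW.apply_rotate hU, hW'.apply_rotate hU, h]

theorem opAct_kernelOf_of_rotate_eq (hW : IsCovariant W) {U : SU2} {R : SO3} (h : Covers U R)
    (hR : rotate R northPole = northPole) : opAct U (kernelOf W) = kernelOf W := by
  refine Matrix.ext_iff_trace_mul_left.2 fun P => ?_
  rw [← hW.apply_rotate h, hR, apply_northPole]

/-- The kernel is fixed by the rotations about the third axis, which stabilize the pole; the
derivative -2i[J₃, K] of the constant curve vanishes. -/
theorem lie_Jthree_kernelOf (hW : IsCovariant W) : ⁅Jthree n, kernelOf W⁆ = 0 := by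
  have hv : (![0, 0, 1] : Fin 3 → ℝ) 0 ^ 2 + (![0, 0, 1] : Fin 3 → ℝ) 1 ^ 2
    + (![0, 0, 1] : Fin 3 → ℝ) 2 ^ 2 = 1 := by simp
  have h1 : ∀ t, opAct (expSU2 _ hv t) (kernelOf W) = kernelOf W := by
    intro t
    refine hW.opAct_kernelOf_of_rotate_eq (covers_mkSU2 _ _ _
      ((normSq_add_normSq_eq_one_iff _ _).1 (normSq_exp_eq_one hv t))) ?_
    apply Subtype.ext
    ext i
    rw [coe_rotate, coe_northPole]
    fin_cases i <;> simp [quaternionRotation, Matrix.mulVec, dotProduct, Fin.sum_univ_three]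
  have h2 := hasEntrywiseDeriv_opAct_expSU2 _ hv (kernelOf W)
  simp only [h1] at h2
  have h3 := h2.unique (HasEntrywiseDeriv.const _)
  rw [Jthree_eq_spinDot]
  exact (smul_eq_zero.1 h3).resolve_left (by simp)

/-- Pairing [J₃, K] = 0 with e(l, m) kills every coefficient with m ≠ 0. Reality makes K Hermitian,
so taking real parts of the remaining coefficients loses nothing. -/
theorem kernelOf_eq (hW : IsCovariant W) (hreal : ∀ (P : Op n) (x : S2), W Pᴴ x = conj (W P x)) :
    kernelOf W = zonalKernel n fun l => (hsInner (e n l 0) (kernelOf W)).re := by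
  have hherm : (kernelOf W)ᴴ = kernelOf W := by
    ext a b
    rw [Matrix.conjTranspose_apply, kernelOf, kernelOf, ← starRingEnd_apply, ← hreal]
    simp
  have hre : ∀ l, hsInner (e n l 0) (kernelOf W)
      = ((hsInner (e n l 0) (kernelOf W)).re : ℂ) := by
    intro l
    refine (Complex.conj_eq_iff_re.1 ?_).symm
    rw [hsInner_conj, hsInner, hsInner, hherm, conjTranspose_e_zero, Matrix.trace_mul_comm]
  conv_lhs => rw [eq_sum_e (kernelOf W)]
  refine Finset.sum_congr rfl fun l _ => ?_
  rw [Finset.sum_eq_single 0]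
  · rw [← hre]
  · intro m hm hne
    have h1 := isAdInvariant_hsForm.lie_Jthree (e n l m) (kernelOf W)
    rw [hW.lie_Jthree_kernelOf, map_zero, lie_Jthree_e hm, hsForm_apply, hsInner_smul_left] at h1
    have hm0 : conj (m : ℂ) ≠ 0 := by simpa using hne
    rw [(mul_eq_zero.1 h1).resolve_left hm0, zero_smul]
  · exact fun h => absurd (zero_mem_Icc l) h

theorem apply_e_zero (hW : IsCovariant W) {γ : ℕ → ℝ} (hK : kernelOf W = zonalKernel n γ) {l : ℕ}
    (hl : l ∈ Finset.range (n + 1)) {R : SO3} {U : SU2} (h : Covers U R) :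
    W (e n l 0) (rotate R northPole) = γ l * hsInner (e n l 0) (opAct U (e n l 0)) := by
  rw [hW.apply_rotate h, hK, ← hsInner_e_opAct_zonalKernel U γ hl (zero_mem_Icc l), hsInner,
    conjTranspose_e_zero]

/-- The symbol of e(l, 0) is proportional to γ_l, so it would vanish together with γ_l. -/
theorem coeff_ne_zero (hW : IsCovariant W) (hinj : Function.Injective W) {γ : ℕ → ℝ}
    (hK : kernelOf W = zonalKernel n γ) {l : ℕ} (hl : l ∈ Finset.range (n + 1)) : γ l ≠ 0 := by
  intro h0
  have h1 : W (e n l 0) = 0 := by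
    ext x
    obtain ⟨U, R, hU, rfl⟩ := exists_rotate_northPole x
    rw [hW.apply_e_zero hK hl hU, h0]
    simp
  have h2 : e n l 0 = 0 := hinj (h1.trans (map_zero W).symm)
  have h3 := hsInner_e (n := n) (by rw [Finset.mem_range] at hl; omega : l ≤ n) (zero_mem_Icc l)
    (zero_mem_Icc l)
  rw [if_pos ⟨rfl, rfl⟩, h2] at h3
  simp [hsInner] at h3

/-- The L² product of W_P with the symbol of e(l, m) recovers the coefficient of P there, up to the
nonzero factor γ_l²/(2l + 1). -/
theorem injective (hW : IsCovariant W) {γ : ℕ → ℝ} (hK : kernelOf W = zonalKernel n γ)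
    (hγ : ∀ l ∈ Finset.range (n + 1), γ l ≠ 0) : Function.Injective W := by
  rw [injective_iff_map_eq_zero]
  intro P hP
  rw [eq_sum_e P]
  refine Finset.sum_eq_zero fun l hl => Finset.sum_eq_zero fun m hm => ?_
  have h1 := hW.sphereInner_e hK hl hm P
  have h2 : sphereInner (W (e n l m)) (W P) = 0 := by
    rw [hP]
    simp [sphereInner, sphereMean_const]
  have h3 : ((γ l ^ 2 / (2 * (l : ℝ) + 1) : ℝ) : ℂ) ≠ 0 := by
    rw [Complex.ofReal_ne_zero]
    exact div_ne_zero (pow_ne_zero 2 (hγ l hl)) (by positivity)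
  rw [h2] at h1
  rw [(mul_eq_zero.1 h1.symm).resolve_left h3, zero_smul]

/-- The hypothesis on γ_0 makes the symbol of the identity equal to 1, so the mean is an L² product
with that symbol and sees only degree 0. -/
theorem sphereMean_eq (hW : IsCovariant W) {γ : ℕ → ℝ} (hK : kernelOf W = zonalKernel n γ)
    (h0 : √((n : ℝ) + 1) * γ 0 = 1) (P : Op n) :
    sphereMean (W P) = 1 / ((n : ℂ) + 1) * P.trace := by
  have h1 : W 1 = fun _ => 1 := by
    ext x
    rw [hW.apply_one, hK, trace_zonalKernel, h0, Complex.ofReal_one]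
  have h2 : sphereMean (W P) = sphereInner (W 1) (W P) := by
    simp [sphereInner, h1]
  have hn : (0 : ℝ) < (n : ℝ) + 1 := by positivity
  have hs : √((n : ℝ) + 1) ≠ 0 := (Real.sqrt_pos.2 hn).ne'
  have hγ : γ 0 ^ 2 = 1 / ((n : ℝ) + 1) := by
    rw [eq_div_iff hn.ne', ← Real.sq_sqrt hn.le, ← mul_pow, mul_comm, h0, one_pow]
  rw [h2, ← hW.form_apply, one_eq_smul_e, map_smulₛₗ, LinearMap.smul_apply, hW.form_apply,
    hW.sphereInner_e hK (by simp) (by simp), hsInner_e_zero_zero, hγ, Complex.conj_ofReal,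
    smul_eq_mul]
  have hs' : ((√((n : ℝ) + 1) : ℝ) : ℂ) ≠ 0 := by exact_mod_cast hs
  push_cast
  field_simp
  simp

end IsCovariant

theorem IsSymbolCorrespondence.isCovariant {W : Op n →ₗ[ℂ] (S2 → ℂ)}
    (hW : IsSymbolCorrespondence n W) : IsCovariant W :=
  ⟨fun P => (hW.smooth P).continuous, hW.equivariant⟩

end Kernel

/-! ### Symbol correspondences from polynomials in `J₃` -/

section Construction

variable {n : ℕ}

/-- The map `P ↦ (x ↦ trace (P p(x · J)))`. -/
def polySymbol (n : ℕ) (p : Polynomial ℝ) : Op n →ₗ[ℂ] (S2 → ℂ) where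
  toFun P x := (P * Polynomial.aeval (spinDot n (x : EuclideanSpace ℝ (Fin 3)).ofLp) p).trace
  map_add' P Q := by
    ext x
    simp [add_mul]
  map_smul' c P := by
    ext x
    simp

theorem polySymbol_apply (p : Polynomial ℝ) (P : Op n) (x : S2) : polySymbol n p P x =
    (P * Polynomial.aeval (spinDot n (x : EuclideanSpace ℝ (Fin 3)).ofLp) p).trace := rfl

theorem contDiff_spinDot_apply (a b : Fin (n + 1)) :
    ContDiff ℝ ∞ fun v : EuclideanSpace ℝ (Fin 3) => spinDot n v.ofLp a b := by
  have h : ∀ i, ContDiff ℝ ∞ fun v : EuclideanSpace ℝ (Fin 3) => (v.ofLp i : ℂ) := fun i =>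
    Complex.ofRealCLM.contDiff.comp (EuclideanSpace.proj i : _ →L[ℝ] ℝ).contDiff
  simp only [spinDot_eq_sum, Matrix.sum_apply, Matrix.smul_apply, smul_eq_mul]
  exact ContDiff.sum fun i _ => (h i).mul contDiff_const

theorem contDiff_aeval_spinDot_apply (p : Polynomial ℝ) (a b : Fin (n + 1)) :
    ContDiff ℝ ∞ fun v : EuclideanSpace ℝ (Fin 3) =>
      Polynomial.aeval (spinDot n v.ofLp) p a b := by
  have hpow : ∀ (k : ℕ) (a b : Fin (n + 1)),
      ContDiff ℝ ∞ fun v : EuclideanSpace ℝ (Fin 3) => (spinDot n v.ofLp ^ k) a b := by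
    intro k
    induction k with
    | zero =>
      intro a b
      simp only [pow_zero]
      exact contDiff_const
    | succ k ih =>
      intro a b
      simp only [pow_succ, Matrix.mul_apply]
      exact ContDiff.sum fun c _ => (ih a c).mul (contDiff_spinDot_apply c b)
  simp only [Polynomial.aeval_eq_sum_range, Matrix.sum_apply, Matrix.smul_apply]
  exact ContDiff.sum fun k _ => (hpow k a b).const_smul _

/-- The symbol is the restriction to the sphere of a polynomial in the coordinates of ℝ³. -/
theorem contMDiff_polySymbol (p : Polynomial ℝ) (P : Op n) :
    ContMDiff (𝓡 2) 𝓘(ℝ, ℂ) ∞ (polySymbol n p P) := by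
  have h : ContDiff ℝ ∞ fun v : EuclideanSpace ℝ (Fin 3) =>
      (P * Polynomial.aeval (spinDot n v.ofLp) p).trace := by
    simp only [Matrix.trace, Matrix.diag_apply, Matrix.mul_apply]
    exact ContDiff.sum fun a _ => ContDiff.sum fun b _ =>
      contDiff_const.mul (contDiff_aeval_spinDot_apply p b a)
  exact h.contMDiff.comp contMDiff_coe_sphere

theorem isCovariant_polySymbol (p : Polynomial ℝ) : IsCovariant (polySymbol n p) where
  continuous P := (contMDiff_polySymbol p P).continuous
  equivariant R U h P x := by
    rw [polySymbol_apply, polySymbol_apply, trace_opAct_mul, opAct_aeval, opAct_spinDot n h.inv,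
      coe_rotate]

theorem kernelOf_polySymbol (p : Polynomial ℝ) :
    kernelOf (polySymbol n p) = Polynomial.aeval (Jthree n) p := by
  refine Matrix.ext_iff_trace_mul_left.2 fun P => ?_
  rw [← apply_northPole, polySymbol_apply, coe_northPole, Jthree_eq_spinDot]

theorem polySymbol_conjTranspose (p : Polynomial ℝ) (P : Op n) (x : S2) :
    polySymbol n p Pᴴ x = conj (polySymbol n p P x) := by
  rw [polySymbol_apply, polySymbol_apply, starRingEnd_apply, ← Matrix.trace_conjTranspose,
    Matrix.conjTranspose_mul, conjTranspose_aeval p (conjTranspose_spinDot _),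
    Matrix.trace_mul_comm]

theorem exists_aeval_zonalKernel (n : ℕ) (γ : ℕ → ℝ) :
    ∃ p : Polynomial ℝ, Polynomial.aeval (Jthree n) p = zonalKernel n γ := by
  choose q hq using exists_aeval_e_zero n
  refine ⟨∑ l ∈ Finset.range (n + 1), Polynomial.C (γ l) * q l, ?_⟩
  rw [map_sum]
  refine Finset.sum_congr rfl fun l _ => ?_
  rw [map_mul, hq, Polynomial.aeval_C, Algebra.algebraMap_eq_smul_one, Matrix.smul_mul, one_mul]
  ext a b
  simp

theorem isSymbolCorrespondence_polySymbol {p : Polynomial ℝ} {γ : ℕ → ℝ}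
    (hp : Polynomial.aeval (Jthree n) p = zonalKernel n γ) (h0 : √((n : ℝ) + 1) * γ 0 = 1)
    (hγ : ∀ l ∈ Finset.range (n + 1), γ l ≠ 0) :
    IsSymbolCorrespondence n (polySymbol n p) where
  smooth := contMDiff_polySymbol p
  injective := (isCovariant_polySymbol p).injective ((kernelOf_polySymbol p).trans hp) hγ
  equivariant := (isCovariant_polySymbol p).equivariant
  reality := polySymbol_conjTranspose p
  normalization := (isCovariant_polySymbol p).sphereMean_eq ((kernelOf_polySymbol p).trans hp) h0

theorem exists_symbolCorrespondence {γ : ℕ → ℝ} (h0 : √((n : ℝ) + 1) * γ 0 = 1)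
    (hγ : ∀ l ∈ Finset.range (n + 1), γ l ≠ 0) :
    ∃ W : SymbolCorrespondence n, W.kernel = zonalKernel n γ := by
  obtain ⟨p, hp⟩ := exists_aeval_zonalKernel n γ
  exact ⟨⟨_, isSymbolCorrespondence_polySymbol hp h0 hγ⟩, (kernelOf_polySymbol p).trans hp⟩

end Construction

/-! ### Characteristic numbers -/

namespace SymbolCorrespondence

variable {n : ℕ}

theorem isCovariant (W : SymbolCorrespondence n) : IsCovariant W.1 := W.2.isCovariant

theorem kernel_eq_kernelOf (W : SymbolCorrespondence n) : W.kernel = kernelOf W.1 := rfl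

theorem kernelOf_eq_zonalKernel (W : SymbolCorrespondence n) :
    kernelOf W.1 = zonalKernel n W.gamma :=
  W.isCovariant.kernelOf_eq W.2.reality

/-- The normalizing factor in the definition of the characteristic numbers. -/
def weight (n l : ℕ) : ℝ := √((2 * (l : ℝ) + 1) / (n + 1))

theorem weight_pos (n l : ℕ) : 0 < weight n l := Real.sqrt_pos.2 (by positivity)

theorem weight_sq (n l : ℕ) : weight n l ^ 2 = (2 * (l : ℝ) + 1) / (n + 1) :=
  Real.sq_sqrt (by positivity)

theorem sqrt_mul_weight_zero (n : ℕ) : √((n : ℝ) + 1) * weight n 0 = 1 := by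
  rw [weight, ← Real.sqrt_mul (by positivity)]
  simp
  rw [mul_inv_cancel₀ (by positivity)]

theorem gamma_eq (W : SymbolCorrespondence n) (l : ℕ) :
    W.gamma l = W.charNumber l * weight n l :=
  (div_mul_cancel₀ _ (weight_pos n l).ne').symm

theorem gamma_sq_div (W : SymbolCorrespondence n) (l : ℕ) :
    W.gamma l ^ 2 / (2 * (l : ℝ) + 1) = W.charNumber l ^ 2 / ((n : ℝ) + 1) := by
  rw [gamma_eq, mul_pow, weight_sq]
  field_simp

theorem sphereInner_symbol (W : SymbolCorrespondence n) (P Q : Op n) :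
    sphereInner (W.symbol P) (W.symbol Q) = ∑ l ∈ Finset.range (n + 1),
      ((W.gamma l ^ 2 / (2 * (l : ℝ) + 1) : ℝ) : ℂ) * hsInner (component l P) (component l Q) :=
  W.isCovariant.sphereInner_eq W.kernelOf_eq_zonalKernel P Q

theorem charNumber_ne_zero (W : SymbolCorrespondence n) {l : ℕ} (hl : l ∈ Finset.range (n + 1)) :
    W.charNumber l ≠ 0 :=
  div_ne_zero (W.isCovariant.coeff_ne_zero W.2.injective W.kernelOf_eq_zonalKernel hl)
    (weight_pos n l).ne'

theorem charNumber_zero (W : SymbolCorrespondence n) : W.charNumber 0 = 1 := by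
  have h1 : sphereMean (W.1 1) = (kernelOf W.1).trace := by
    rw [funext W.isCovariant.apply_one, sphereMean_const]
  have hn : ((n : ℂ) + 1) ≠ 0 := by exact_mod_cast Nat.succ_ne_zero n
  rw [W.2.normalization, W.kernelOf_eq_zonalKernel, trace_zonalKernel] at h1
  simp only [Matrix.trace_one, Fintype.card_fin] at h1
  push_cast at h1
  rw [one_div_mul_cancel hn] at h1
  have h2 : √((n : ℝ) + 1) * W.gamma 0 = 1 := by exact_mod_cast h1.symm
  rw [gamma_eq, mul_left_comm, sqrt_mul_weight_zero, mul_one] at h2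
  exact h2

/-- The metric identity compares the two products degree by degree, with ratio c_l²; testing on e(l,
0) isolates one degree. -/
theorem isStratonovichWeyl_iff (W : SymbolCorrespondence n) : W.IsStratonovichWeyl ↔
    ∀ l ∈ Finset.Icc 1 n, W.charNumber l = 1 ∨ W.charNumber l = -1 := by
  constructor
  · intro h l hl
    have hl' : l ∈ Finset.range (n + 1) := by
      rw [Finset.mem_Icc] at hl
      rw [Finset.mem_range]
      omega
    have h1 := h (e n l 0) (e n l 0)
    have h2 := W.isCovariant.sphereInner_e W.kernelOf_eq_zonalKernel hl' (zero_mem_Icc l) (e n l 0)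
    have h3 := h1.symm.trans h2
    rw [gamma_sq_div, hsInner_e (by rw [Finset.mem_range] at hl'; omega) (zero_mem_Icc l)
      (zero_mem_Icc l), if_pos ⟨rfl, rfl⟩, mul_one, mul_one] at h3
    have h4 : 1 / ((n : ℝ) + 1) = W.charNumber l ^ 2 / ((n : ℝ) + 1) := by
      apply Complex.ofReal_injective
      push_cast at h3 ⊢
      exact h3
    have hn : ((n : ℝ) + 1) ≠ 0 := by positivity
    exact mul_self_eq_one_iff.1 (by rw [← sq, ← (div_left_inj' hn).1 h4])
  · intro h P Q
    rw [sphereInner_symbol, hsInner_eq_sum_component, Finset.mul_sum]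
    refine Finset.sum_congr rfl fun l hl => ?_
    have h1 : W.charNumber l ^ 2 = 1 := by
      rcases Nat.eq_zero_or_pos l with rfl | hpos
      · rw [charNumber_zero, one_pow]
      · rcases h l (by rw [Finset.mem_range] at hl; rw [Finset.mem_Icc]; omega) with h2 | h2 <;>
          simp [h2]
    rw [gamma_sq_div, h1]
    push_cast
    rfl

end SymbolCorrespondence

/-! ### The moduli space -/

namespace SymbolCorrespondence

variable {n : ℕ}

theorem symbol_rotate (W : SymbolCorrespondence n) {R : SO3} {U : SU2} (h : Covers U R)
    (P : Op n) : W.symbol P (rotate R northPole) = ∑ l ∈ Finset.range (n + 1),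
      ((W.charNumber l * weight n l : ℝ) : ℂ) * (P * opAct U (e n l 0)).trace := by
  change W.1 P _ = _
  rw [W.isCovariant.apply_rotate h, W.kernelOf_eq_zonalKernel, opAct_zonalKernel, Finset.mul_sum,
    Matrix.trace_sum]
  refine Finset.sum_congr rfl fun l _ => ?_
  rw [Matrix.mul_smul, Matrix.trace_smul, smul_eq_mul, gamma_eq]

theorem ext_charNumber {W W' : SymbolCorrespondence n}
    (h : ∀ i : Fin n, W.charNumber ((i : ℕ) + 1) = W'.charNumber ((i : ℕ) + 1)) : W = W' := by
  refine Subtype.ext (W.isCovariant.ext_kernelOf W'.isCovariant ?_)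
  rw [W.kernelOf_eq_zonalKernel, W'.kernelOf_eq_zonalKernel]
  refine Finset.sum_congr rfl fun l hl => ?_
  rw [gamma_eq, gamma_eq]
  congr 3
  rcases l with _ | l
  · rw [charNumber_zero, charNumber_zero]
  · exact h ⟨l, by rw [Finset.mem_range] at hl; omega⟩

/-- The sequence `1, c₁, …, cₙ, 0, …` attached to `c`. -/
def extendByOne (c : Fin n → ℝ) (l : ℕ) : ℝ :=
  if h : 1 ≤ l ∧ l ≤ n then c ⟨l - 1, by omega⟩ else 1

theorem extendByOne_succ (c : Fin n → ℝ) (i : Fin n) : extendByOne c ((i : ℕ) + 1) = c i := by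
  rw [extendByOne, dif_pos (by omega)]
  rfl

theorem exists_charNumber_eq (c : Fin n → ℝ) (hc : ∀ i, c i ≠ 0) :
    ∃ W : SymbolCorrespondence n, ∀ i : Fin n, W.charNumber ((i : ℕ) + 1) = c i := by
  have h0 : extendByOne c 0 = 1 := by simp [extendByOne]
  obtain ⟨W, hW⟩ := exists_symbolCorrespondence (n := n)
    (γ := fun l => extendByOne c l * weight n l)
    (by rw [h0, one_mul, sqrt_mul_weight_zero])
    (fun l _ => by
      refine mul_ne_zero ?_ (weight_pos n l).ne'
      rw [extendByOne]
      -- Outside 1 ≤ l ≤ n the value of `extendByOne` is 1.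
      split_ifs
      · exact hc _
      · exact one_ne_zero)
  refine ⟨W, fun i => ?_⟩
  rw [charNumber, gamma, hW, hsInner_e_zonalKernel _ (by simp), Complex.ofReal_re,
    extendByOne_succ]
  exact mul_div_cancel_right₀ _ (weight_pos n _).ne'

theorem continuous_symbol (P : Op n) (x : S2) :
    Continuous fun W : SymbolCorrespondence n => W.symbol P x :=
  (continuous_apply x).comp ((continuous_apply P).comp continuous_induced_dom)

theorem continuous_charNumber (l : ℕ) :
    Continuous fun W : SymbolCorrespondence n => W.charNumber l := by
  have h : ∀ a b, Continuous fun W : SymbolCorrespondence n => W.kernel a b :=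
    fun a b => continuous_symbol _ _
  unfold charNumber gamma hsInner
  refine Continuous.div_const (Complex.continuous_re.comp ?_) _
  simp only [Matrix.trace, Matrix.diag_apply, Matrix.mul_apply]
  exact continuous_finsetSum _ fun a _ => continuous_finsetSum _ fun b _ =>
    continuous_const.mul (h b a)

/-- The symbol correspondence with characteristic numbers `c`. -/
def ofCharNumbers (c : {c : Fin n → ℝ // ∀ i, c i ≠ 0}) : SymbolCorrespondence n :=
  (exists_charNumber_eq c.1 c.2).choose

theorem charNumber_ofCharNumbers (c : {c : Fin n → ℝ // ∀ i, c i ≠ 0}) (i : Fin n) :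
    (ofCharNumbers c).charNumber ((i : ℕ) + 1) = c.1 i :=
  (exists_charNumber_eq c.1 c.2).choose_spec i

/-- At a fixed operator and point the symbol is affine in the characteristic numbers, with c_0 = 1
giving the constant term. -/
theorem continuous_ofCharNumbers :
    Continuous (ofCharNumbers : {c : Fin n → ℝ // ∀ i, c i ≠ 0} → SymbolCorrespondence n) := by
  refine continuous_induced_rng.2 (continuous_pi fun P => continuous_pi fun x => ?_)
  obtain ⟨U, R, hU, rfl⟩ := exists_rotate_northPole x
  simp only [Function.comp_apply, symbol_rotate _ hU]
  refine continuous_finsetSum _ fun l hl => Continuous.mul (Complex.continuous_ofReal.comp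
    (Continuous.mul ?_ continuous_const)) continuous_const
  rcases l with _ | l
  · simp only [charNumber_zero]
    exact continuous_const
  · have hl' : l < n := by rw [Finset.mem_range] at hl; omega
    have h := fun c => charNumber_ofCharNumbers (n := n) c ⟨l, hl'⟩
    dsimp only at h
    simp only [h]
    exact (continuous_apply _).comp continuous_subtype_val

/-- The moduli space of symbol correspondences is `(ℝ*)ⁿ`. -/
def charNumberHomeomorph (n : ℕ) :
    SymbolCorrespondence n ≃ₜ {c : Fin n → ℝ // ∀ i, c i ≠ 0} where
  toFun W := ⟨fun i => W.charNumber ((i : ℕ) + 1), fun i => W.charNumber_ne_zero (by simp)⟩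
  invFun := ofCharNumbers
  left_inv W := ext_charNumber fun i => charNumber_ofCharNumbers _ i
  right_inv c := Subtype.ext (funext fun i => charNumber_ofCharNumbers c i)
  continuous_toFun := Continuous.subtype_mk
    (continuous_pi fun i => continuous_charNumber _) _
  continuous_invFun := continuous_ofCharNumbers

theorem isStratonovichWeyl_iff_fin (W : SymbolCorrespondence n) : W.IsStratonovichWeyl ↔
    ∀ i : Fin n, W.charNumber ((i : ℕ) + 1) = 1 ∨ W.charNumber ((i : ℕ) + 1) = -1 := by
  rw [isStratonovichWeyl_iff]
  constructor
  · exact fun h i => h _ (by rw [Finset.mem_Icc]; omega)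
  · intro h l hl
    rw [Finset.mem_Icc] at hl
    obtain ⟨k, rfl⟩ : ∃ k, l = k + 1 := ⟨l - 1, by omega⟩
    exact h ⟨k, by omega⟩

/-- Stratonovich-Weyl correspondences are classified by their signs. -/
def stratonovichWeylEquiv (n : ℕ) :
    {W : SymbolCorrespondence n // W.IsStratonovichWeyl} ≃ (Fin n → ℤˣ) where
  toFun W i := if W.1.charNumber ((i : ℕ) + 1) = 1 then 1 else -1
  invFun s := ⟨ofCharNumbers ⟨fun i => ((s i : ℤ) : ℝ), fun i => by
      rcases Int.units_eq_one_or (s i) with h | h <;> simp [h]⟩, by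
    rw [isStratonovichWeyl_iff_fin]
    intro i
    rw [charNumber_ofCharNumbers]
    rcases Int.units_eq_one_or (s i) with h | h <;> simp [h]⟩
  left_inv W := by
    refine Subtype.ext (ext_charNumber fun i => ?_)
    rw [charNumber_ofCharNumbers]
    rcases (isStratonovichWeyl_iff_fin W.1).1 W.2 i with h | h
    · simp [h]
    · have h1 : ¬ (-1 : ℝ) = 1 := by norm_num
      simp [h, h1]
  right_inv s := by
    ext i
    simp only [charNumber_ofCharNumbers]
    rcases Int.units_eq_one_or (s i) with h | h
    · simp [h]
    · simp only [h, Units.val_neg, Units.val_one, Int.cast_neg, Int.cast_one]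
      rw [if_neg (by norm_num)]
      simp

theorem card_stratonovichWeyl (n : ℕ) :
    Nat.card {W : SymbolCorrespondence n // W.IsStratonovichWeyl} = 2 ^ n := by
  rw [Nat.card_congr (stratonovichWeylEquiv n), Nat.card_eq_fintype_card, Fintype.card_fun,
    Fintype.card_units_int, Fintype.card_fin]

theorem rescale_ne_zero {t r : ℝ} (h0 : 0 ≤ t) (h1 : t ≤ 1) (hr : r ≠ 0) :
    r * (1 - t + t * |r|⁻¹) ≠ 0 := by
  have hr' : 0 < |r|⁻¹ := inv_pos.2 (abs_pos.2 hr)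
  refine mul_ne_zero hr (ne_of_gt ?_)
  rcases h0.eq_or_lt with h | h
  · rw [← h]
    norm_num
  · have := mul_pos h hr'
    linarith

/-- The deformation of the moduli space that moves all characteristic numbers to their signs. -/
def deformation (n : ℕ) : C(unitInterval × SymbolCorrespondence n, SymbolCorrespondence n) where
  toFun q := ofCharNumbers ⟨fun i => q.2.charNumber ((i : ℕ) + 1) *
      (1 - (q.1 : ℝ) + (q.1 : ℝ) * |q.2.charNumber ((i : ℕ) + 1)|⁻¹), fun i =>
    rescale_ne_zero q.1.2.1 q.1.2.2 (q.2.charNumber_ne_zero (by simp))⟩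
  continuous_toFun := by
    refine continuous_ofCharNumbers.comp (Continuous.subtype_mk (continuous_pi fun i => ?_) _)
    have h1 : Continuous fun q : unitInterval × SymbolCorrespondence n => (q.1 : ℝ) :=
      continuous_subtype_val.comp continuous_fst
    have h2 : Continuous fun q : unitInterval × SymbolCorrespondence n =>
      q.2.charNumber ((i : ℕ) + 1) := (continuous_charNumber _).comp continuous_snd
    refine h2.mul ((continuous_const.sub h1).add (h1.mul (h2.abs.inv₀ fun q => ?_)))
    exact abs_ne_zero.2 (q.2.charNumber_ne_zero (by simp))

theorem charNumber_deformation (t : unitInterval) (W : SymbolCorrespondence n) (i : Fin n) :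
    (deformation n (t, W)).charNumber ((i : ℕ) + 1) = W.charNumber ((i : ℕ) + 1) *
      (1 - (t : ℝ) + (t : ℝ) * |W.charNumber ((i : ℕ) + 1)|⁻¹) :=
  charNumber_ofCharNumbers _ i

theorem deformation_zero (W : SymbolCorrespondence n) : deformation n (0, W) = W :=
  ext_charNumber fun i => by simp [charNumber_deformation]

theorem deformation_one (W : SymbolCorrespondence n) :
    (deformation n (1, W)).IsStratonovichWeyl := by
  rw [isStratonovichWeyl_iff_fin]
  intro i
  have h : W.charNumber ((i : ℕ) + 1) ≠ 0 := W.charNumber_ne_zero (by simp)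
  rw [charNumber_deformation]
  simp only [Set.Icc.coe_one, sub_self, zero_add, one_mul]
  rcases abs_choice (W.charNumber ((i : ℕ) + 1)) with h1 | h1
  · rw [h1, mul_inv_cancel₀ h]
    exact Or.inl rfl
  · rw [h1, inv_neg, mul_neg, mul_inv_cancel₀ h]
    exact Or.inr rfl

theorem deformation_of_isStratonovichWeyl (t : unitInterval) {S : SymbolCorrespondence n}
    (hS : S.IsStratonovichWeyl) : deformation n (t, S) = S := by
  refine ext_charNumber fun i => ?_
  rw [charNumber_deformation]
  rcases (isStratonovichWeyl_iff_fin S).1 hS i with h | h <;> rw [h] <;> simp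

/-- The deformation itself is a path from W to its endpoint. -/
theorem mk_deformation_one (W : SymbolCorrespondence n) :
    ConnectedComponents.mk (deformation n (1, W)) = ConnectedComponents.mk W := by
  rw [ConnectedComponents.coe_eq_coe']
  have hpre : IsPreconnected (Set.range fun t : unitInterval => deformation n (t, W)) :=
    isPreconnected_range ((deformation n).continuous.comp (by fun_prop))
  exact hpre.subset_connectedComponent ⟨0, deformation_zero W⟩ ⟨1, rfl⟩

/-- The image of a component under a characteristic number is an interval that avoids 0, so 1 and -1
cannot both lie in it. -/
theorem eq_of_mk_eq {S S' : SymbolCorrespondence n} (hS : S.IsStratonovichWeyl)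
    (hS' : S'.IsStratonovichWeyl)
    (h : ConnectedComponents.mk S = ConnectedComponents.mk S') : S = S' := by
  refine ext_charNumber fun i => ?_
  have hmem : S ∈ connectedComponent S' := ConnectedComponents.coe_eq_coe'.1 h
  have himg := (isPreconnected_connectedComponent (x := S')).image _
    (continuous_charNumber (n := n) ((i : ℕ) + 1)).continuousOn
  have h1 := Set.mem_image_of_mem
    (fun W : SymbolCorrespondence n => W.charNumber ((i : ℕ) + 1)) hmem
  have h2 := Set.mem_image_of_mem (fun W : SymbolCorrespondence n => W.charNumber ((i : ℕ) + 1))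
    (mem_connectedComponent (x := S'))
  have key : (0 : ℝ) ∉ (fun W : SymbolCorrespondence n => W.charNumber ((i : ℕ) + 1)) ''
      connectedComponent S' := by
    rintro ⟨W, _, hW⟩
    exact W.charNumber_ne_zero (by simp) hW
  have hord := himg.ordConnected
  rcases (isStratonovichWeyl_iff_fin S).1 hS i with h3 | h3 <;>
    rcases (isStratonovichWeyl_iff_fin S').1 hS' i with h4 | h4
  · rw [h3, h4]
  · exact absurd (hord.out h2 h1 ⟨by simp [h4], by simp [h3]⟩) key
  · exact absurd (hord.out h1 h2 ⟨by simp [h3], by simp [h4]⟩) key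
  · rw [h3, h4]

theorem existsUnique_stratonovichWeyl (C : ConnectedComponents (SymbolCorrespondence n)) :
    ∃! S : SymbolCorrespondence n, S.IsStratonovichWeyl ∧ ConnectedComponents.mk S = C := by
  obtain ⟨W, rfl⟩ := ConnectedComponents.surjective_coe C
  exact ⟨deformation n (1, W), ⟨deformation_one W, mk_deformation_one W⟩, fun S hS =>
    eq_of_mk_eq hS.1 (deformation_one W) (hS.2.trans (mk_deformation_one W).symm)⟩

theorem card_connectedComponents (n : ℕ) :
    Nat.card (ConnectedComponents (SymbolCorrespondence n)) = 2 ^ n := by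
  rw [← card_stratonovichWeyl n]
  refine (Nat.card_eq_of_bijective
    (fun S : {W : SymbolCorrespondence n // W.IsStratonovichWeyl} => ConnectedComponents.mk S.1)
    ⟨fun S S' h => Subtype.ext (eq_of_mk_eq S.2 S'.2 h), fun C => ?_⟩).symm
  obtain ⟨S, hS, _⟩ := existsUnique_stratonovichWeyl C
  exact ⟨⟨S, hS.1⟩, hS.2⟩

end SymbolCorrespondence

end SpinSystem

end

open SpinSystem in
theorem proposition6p2p3 (n : ℕ) :
    -- the decomposition of operators into their components
    (∀ P : Op n, P = ∑ l ∈ Finset.range (n + 1), component l P) ∧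
    -- the operator kernel and the characteristic numbers of a symbol correspondence
    (∀ W : SymbolCorrespondence n,
      (∀ (R : SO3) (U : SU2), Covers U R → ∀ P : Op n,
        W.symbol P (rotate R northPole) = (P * opAct U W.kernel).trace) ∧
      W.kernel = ∑ l ∈ Finset.range (n + 1),
        ((W.charNumber l * √((2 * (l : ℝ) + 1) / (n + 1)) : ℝ) : ℂ) • e n l 0 ∧
      W.charNumber 0 = 1 ∧
      ∀ l ∈ Finset.Icc 1 n, W.charNumber l ≠ 0) ∧
    -- the metric identity
    (∀ (W : SymbolCorrespondence n) (P Q : Op n),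
      sphereInner (W.symbol P) (W.symbol Q) =
        ∑ l ∈ Finset.range (n + 1), ((W.gamma l ^ 2 / (2 * (l : ℝ) + 1) : ℝ) : ℂ) *
          hsInner (component l P) (component l Q) ∧
      sphereInner (W.symbol P) (W.symbol Q) =
        ∑ l ∈ Finset.range (n + 1), ((W.charNumber l ^ 2 / ((n : ℝ) + 1) : ℝ) : ℂ) *
          hsInner (component l P) (component l Q)) ∧
    -- Stratonovich-Weyl correspondences
    (∀ W : SymbolCorrespondence n, W.IsStratonovichWeyl ↔
      ∀ l ∈ Finset.Icc 1 n, W.charNumber l = 1 ∨ W.charNumber l = -1) ∧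
    {W : SymbolCorrespondence n | W.IsStratonovichWeyl}.ncard = 2 ^ n ∧
    -- the moduli space is `(ℝ*)ⁿ`, through the characteristic numbers
    (∃ h : SymbolCorrespondence n ≃ₜ {c : Fin n → ℝ // ∀ i, c i ≠ 0},
      ∀ (W : SymbolCorrespondence n) (i : Fin n),
        (h W : Fin n → ℝ) i = W.charNumber ((i : ℕ) + 1)) ∧
    -- it has `2ⁿ` connected components, each with a unique Stratonovich-Weyl correspondence
    Nat.card (ConnectedComponents (SymbolCorrespondence n)) = 2 ^ n ∧
    (∀ C : ConnectedComponents (SymbolCorrespondence n),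
      ∃! S : SymbolCorrespondence n, S.IsStratonovichWeyl ∧ ConnectedComponents.mk S = C) ∧
    -- and it deforms, relative to the Stratonovich-Weyl correspondences, onto these
    (∃ H : C(unitInterval × SymbolCorrespondence n, SymbolCorrespondence n),
      (∀ W, H (0, W) = W) ∧
      (∀ W, (H (1, W)).IsStratonovichWeyl) ∧
      ∀ (t : unitInterval) (S : SymbolCorrespondence n), S.IsStratonovichWeyl → H (t, S) = S) := by

  refine ⟨fun P => eq_sum_component P, fun W => ⟨fun R U h P => ?_, ?_, W.charNumber_zero,
    fun l hl => W.charNumber_ne_zero ?_⟩, fun W P Q => ⟨W.sphereInner_symbol P Q, ?_⟩,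
    fun W => W.isStratonovichWeyl_iff, ?_,
    ⟨SymbolCorrespondence.charNumberHomeomorph n, fun W i => rfl⟩,
    SymbolCorrespondence.card_connectedComponents n,
    SymbolCorrespondence.existsUnique_stratonovichWeyl,
    SymbolCorrespondence.deformation n, SymbolCorrespondence.deformation_zero,
    SymbolCorrespondence.deformation_one,
    fun t S hS => SymbolCorrespondence.deformation_of_isStratonovichWeyl t hS⟩
  · exact W.isCovariant.apply_rotate h P
  · rw [W.kernel_eq_kernelOf, W.kernelOf_eq_zonalKernel]
    refine Finset.sum_congr rfl fun l _ => ?_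
    rw [W.gamma_eq]
    rfl
  · rw [Finset.mem_Icc] at hl
    rw [Finset.mem_range]
    omega
  · rw [W.sphereInner_symbol]
    simp only [W.gamma_sq_div]
  · exact SymbolCorrespondence.card_stratonovichWeyl n
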